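/- Let $K$ be a field of characteristic different from $2$. A superalgebra is a (not necessarily associative or unital) $K$-algebra $A=A_0\oplus A_1$ with $A_iA_j\subseteq A_{i+j}$ (indices mod $2$); for $a\in A_i$ write $\overline a=i$. It is bicommutative if $a(bc)=(-1)^{\overline a\,\overline b}\,b(ac)$ and $(ab)c=(-1)^{\overline b\,\overline c}\,(ac)b$ for all homogeneous $a,b,c\in A$, and super-commutative if $ba=(-1)^{\overline a\,\overline b}ab$ for all homogeneous $a,b\in A$. Let $X=Y\sqcup Z$, where $Y$ (even generators) and $Z$ (odd generators) are totally ordered sets (for example well-ordered sets). Let $F$ be the quotient of the free nonassociative algebra $K\{X\}$, graded by the parity of words, by the ideal generated by all $a(bc)-(-1)^{\overline a\,\overline b}b(ac)$ and $(ab)c-(-1)^{\overline b\,\overline c}(ac)b$ with $a,b,c\in K\{X\}$ homogeneous. Then: 1. $F$ is the free bicommutative superalgebra on $X$: with the induced grading it is a bicommutative superalgebra in which each $x\in X$ has its given parity, and every parity-preserving map from $X$ to a bicommutative superalgebra $A$ extends uniquely to a grading-preserving homomorphism $F\to A$. 2. $X\cup M$ is a basis of the vector space $F$ (its elements, as listed,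 being pairwise distinct), where $M$ consists of the monomials $$y_1(\cdots(y_k(z_1(\cdots(z_{l-1}((\cdots(((\cdots(z_ly_{k+1})\cdots)y_{k+m})z_{l+1})\cdots)z_{l+n}))\cdots)))\cdots)$$ with $y_i\in Y$, $z_i\in Z$, $y_1\le\cdots\le y_k$, $y_{k+1}\le\cdots\le y_{k+m}$, $z_1<\cdots<z_l$, $z_{l+1}<\cdots<z_{l+n}$, $k+l>0$, $m+n>0$. That is, if $a_1,\dots,a_p$ is the sequence $y_1,\dots,y_k,z_1,\dots,z_l$ and $b_1,\dots,b_q$ is the sequence $y_{k+1},\dots,y_{k+m},z_{l+1},\dots,z_{l+n}$, the monomial is $a_1(\cdots(a_{p-1}((\cdots(a_pb_1)\cdots)b_q))\cdots)$. 3. Let $S$ be the free super-commutative algebra on $X$, i.e. the associative unital algebra generated by $X$ with defining relations $yx=xy$ ($y\in Y$, $x\in X$) and $z_2z_1=-z_1z_2$ ($z_1,z_2\in Z$), graded by parity, and let $\omega\subset S$ be the kernel of the homomorphism $S\to K$ sending all of $X$ to $0$. Let $G=KX\oplus(\omega\otimes_K\omega)$ with the bilinear multiplication given, for $x,x'\in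 X$ and $u,v,u_i,v_i\in\omega$ (homogeneous where parities occur), by $$x\circ x'=x\otimes x',\quad x\circ(u\otimes v)=xu\otimes v,\quad (u\otimes v)\circ x=u\otimes vx,$$ $$(u_1\otimes v_1)\circ(u_2\otimes v_2)=(-1)^{\overline{v_1}(\overline{u_2}+\overline{v_2})}\,u_1u_2\otimes v_2v_1,$$ graded by the parity of $x\in X$ and $\overline{u\otimes v}=\overline u+\overline v$. Then there is an isomorphism of superalgebras (an algebra isomorphism that identifies the homogeneous components) $F\to G$ sending each $x\in X$ to $x$. 4. For every bicommutative superalgebra $A$ over $K$, the square $A^2$ (the span of all products $ab$) is, with the grading induced from $A$, an associative super-commutative superalgebra. -/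

import Mathlib

open scoped TensorProduct DirectSum

namespace BicommSuper

/-! ### Superalgebras, not necessarily associative or unital -/

section Superalgebras

variable {K : Type*} [Field K] {A : Type*} [NonUnitalNonAssocRing A] [Module K A]

/-- The sign `(-1)^{ij}` attached to two parities `i, j ∈ ℤ/2`. -/
def koszulSign (i j : ZMod 2) : ℤ := (-1) ^ (i.val * j.val)

/-- `A = A₀ ⊕ A₁` is a superalgebra: it is the direct sum of the subspaces `A₀`, `A₁`, and
`A_i A_j ⊆ A_{i+j}`. -/
structure IsSuperalgebra (𝒜 : ZMod 2 → Submodule K A) : Prop where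
  isInternal : DirectSum.IsInternal 𝒜
  mul_mem : ∀ {i j : ZMod 2} {a b : A}, a ∈ 𝒜 i → b ∈ 𝒜 j → a * b ∈ 𝒜 (i + j)

/-- A bicommutative superalgebra: a superalgebra in which homogeneous elements satisfy
`a(bc) = (-1)^{|a||b|} b(ac)` and `(ab)c = (-1)^{|b||c|} (ac)b`. -/
structure IsBicommutativeSuperalgebra (𝒜 : ZMod 2 → Submodule K A) : Prop
    extends IsSuperalgebra 𝒜 where
  left_comm : ∀ {i j k : ZMod 2} {a b c : A}, a ∈ 𝒜 i → b ∈ 𝒜 j → c ∈ 𝒜 k →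
    a * (b * c) = koszulSign i j • (b * (a * c))
  right_comm : ∀ {i j k : ZMod 2} {a b c : A}, a ∈ 𝒜 i → b ∈ 𝒜 j → c ∈ 𝒜 k →
    (a * b) * c = koszulSign j k • ((a * c) * b)

/-- Super-commutativity: `ba = (-1)^{|a||b|} ab` for homogeneous `a, b`. -/
def IsSuperCommutative (𝒜 : ZMod 2 → Submodule K A) : Prop :=
  ∀ {i j : ZMod 2} {a b : A}, a ∈ 𝒜 i → b ∈ 𝒜 j → b * a = koszulSign i j • (a * b)

variable (K A) in
/-- The square `A²` of an algebra: the linear span of all products `ab`, as a subalgebra. -/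
def square : NonUnitalSubalgebra K A where
  __ := Submodule.span K {x : A | ∃ a b : A, x = a * b}
  mul_mem' := fun {a b} _ _ => Submodule.subset_span ⟨a, b, rfl⟩

/-- The grading induced on a subalgebra: the homogeneous elements of `B` are the elements of `B`
that are homogeneous in `A`. -/
def inducedGrading (𝒜 : ZMod 2 → Submodule K A) (B : NonUnitalSubalgebra K A) :
    ZMod 2 → Submodule K B :=
  fun i => (𝒜 i).comap B.toSubmodule.subtype

end Superalgebras

section Generators

variable (K : Type*) [Field K] (Y Z : Type*)

/-- The parity of a generator: those in `Y` are even, those in `Z` are odd. -/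
def genParity {Y Z : Type*} : Y ⊕ Z → ZMod 2
  | .inl _ => 0
  | .inr _ => 1

/-! ### The free bicommutative superalgebra -/

/-- The parity of a nonassociative word: the sum of the parities of its letters. -/
def wordParity {Y Z : Type*} : FreeMagma (Y ⊕ Z) → ZMod 2
  | .of x => genParity x
  | .mul u v => wordParity u + wordParity v

/-- The homogeneous components of the free nonassociative algebra on `Y ⊕ Z`. -/
noncomputable def nonAssocGrading (i : ZMod 2) : Submodule K (FreeNonUnitalNonAssocAlgebra K (Y ⊕ Z)) :=
  Submodule.span K {n | ∃ w : FreeMagma (Y ⊕ Z),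
    wordParity w = i ∧ n = MonoidAlgebra.ofMagma K (FreeMagma (Y ⊕ Z)) w}

/-- The values of the two bicommutativity super-identities at homogeneous elements of the free
nonassociative algebra. -/
inductive IsIdentityValue : FreeNonUnitalNonAssocAlgebra K (Y ⊕ Z) → Prop
  | left {i j k : ZMod 2} {a b c : FreeNonUnitalNonAssocAlgebra K (Y ⊕ Z)}
      (ha : a ∈ nonAssocGrading K Y Z i) (hb : b ∈ nonAssocGrading K Y Z j)
      (hc : c ∈ nonAssocGrading K Y Z k) :
      IsIdentityValue (a * (b * c) - koszulSign i j • (b * (a * c)))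
  | right {i j k : ZMod 2} {a b c : FreeNonUnitalNonAssocAlgebra K (Y ⊕ Z)}
      (ha : a ∈ nonAssocGrading K Y Z i) (hb : b ∈ nonAssocGrading K Y Z j)
      (hc : c ∈ nonAssocGrading K Y Z k) :
      IsIdentityValue ((a * b) * c - koszulSign j k • ((a * c) * b))

/-- The two-sided ideal generated by the values of the super-identities. -/
noncomputable def identityIdeal : Submodule K (FreeNonUnitalNonAssocAlgebra K (Y ⊕ Z)) :=
  sInf {J | (∀ x, IsIdentityValue K Y Z x → x ∈ J) ∧ ∀ a x, x ∈ J → a * x ∈ J ∧ x * a ∈ J}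

theorem identityIdeal_mul_mem {a x : FreeNonUnitalNonAssocAlgebra K (Y ⊕ Z)}
    (hx : x ∈ identityIdeal K Y Z) :
    a * x ∈ identityIdeal K Y Z ∧ x * a ∈ identityIdeal K Y Z := by
  simp only [identityIdeal, Submodule.mem_sInf, Set.mem_ofPred_eq] at hx ⊢
  exact ⟨fun J hJ => (hJ.2 a x (hx J hJ)).1, fun J hJ => (hJ.2 a x (hx J hJ)).2⟩

/-- The free bicommutative superalgebra with even generators `Y` and odd generators `Z`: the
quotient of the free nonassociative algebra by the ideal of the super-identities. -/
def FreeBicomm : Type _ := FreeNonUnitalNonAssocAlgebra K (Y ⊕ Z) ⧸ identityIdeal K Y Z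

namespace FreeBicomm

noncomputable instance : AddCommGroup (FreeBicomm K Y Z) :=
  inferInstanceAs (AddCommGroup (_ ⧸ identityIdeal K Y Z))

noncomputable instance : Module K (FreeBicomm K Y Z) :=
  inferInstanceAs (Module K (_ ⧸ identityIdeal K Y Z))

/-- The quotient map from the free nonassociative algebra. -/
noncomputable def mk : FreeNonUnitalNonAssocAlgebra K (Y ⊕ Z) →ₗ[K] FreeBicomm K Y Z :=
  (identityIdeal K Y Z).mkQ

theorem mk_surjective : Function.Surjective (mk K Y Z) := Submodule.mkQ_surjective _

/-- The multiplication induced on the quotient. -/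
noncomputable def mulMap : FreeBicomm K Y Z →ₗ[K] FreeBicomm K Y Z →ₗ[K] FreeBicomm K Y Z :=
  (identityIdeal K Y Z).liftQ
    (LinearMap.flip ((identityIdeal K Y Z).liftQ
      (((LinearMap.mul K (FreeNonUnitalNonAssocAlgebra K (Y ⊕ Z))).compr₂ (mk K Y Z)).flip)
      (fun b hb => by
        refine LinearMap.ext fun a => ?_
        exact (Submodule.Quotient.mk_eq_zero _).2 (identityIdeal_mul_mem K Y Z hb).1)))
    (fun a ha => by
      refine LinearMap.ext fun b => ?_
      obtain ⟨b, rfl⟩ := mk_surjective K Y Z b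
      exact (Submodule.Quotient.mk_eq_zero _).2 (identityIdeal_mul_mem K Y Z ha).2)

noncomputable instance : Mul (FreeBicomm K Y Z) := ⟨fun a b => mulMap K Y Z a b⟩

theorem mk_mul (a b : FreeNonUnitalNonAssocAlgebra K (Y ⊕ Z)) :
    mk K Y Z (a * b) = mk K Y Z a * mk K Y Z b := rfl

noncomputable instance : NonUnitalNonAssocRing (FreeBicomm K Y Z) where
  left_distrib a b c := map_add (mulMap K Y Z a) b c
  right_distrib a b c := LinearMap.map_add₂ (mulMap K Y Z) a b c
  zero_mul a := LinearMap.map_zero₂ (mulMap K Y Z) a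
  mul_zero a := map_zero (mulMap K Y Z a)

instance : IsScalarTower K (FreeBicomm K Y Z) (FreeBicomm K Y Z) :=
  ⟨fun r a b => LinearMap.map_smul₂ (mulMap K Y Z) r a b⟩

instance : SMulCommClass K (FreeBicomm K Y Z) (FreeBicomm K Y Z) :=
  ⟨fun r a b => ((mulMap K Y Z a).map_smul r b).symm⟩

/-- The free generators. -/
noncomputable def gen (x : Y ⊕ Z) : FreeBicomm K Y Z :=
  mk K Y Z (FreeNonUnitalNonAssocAlgebra.of K x)

/-- The even and the odd component. -/
noncomputable def grading (i : ZMod 2) : Submodule K (FreeBicomm K Y Z) :=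
  (nonAssocGrading K Y Z i).map (mk K Y Z)

end FreeBicomm

/-! ### The monomials of the basis -/

/-- For `a = [a₁, …, a_p]` and `b = [b₁, …, b_q]` with `p ≥ 1`, the product
`a₁(⋯(a_{p-1}((⋯(a_p b₁)⋯)b_q))⋯)`. The value at `a = []` is a convention that is never used. -/
def bracket {A : Type*} [Mul A] [Zero A] : List A → List A → A
  | [], _ => 0
  | [a], b => b.foldl (· * ·) a
  | a :: a' :: as, b => a * bracket (a' :: as) b

/-- Nonempty words `y₁ ⋯ y_k z₁ ⋯ z_l` with `y₁ ≤ ⋯ ≤ y_k` in `Y` and `z₁ < ⋯ < z_l` in `Z`,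
`k + l > 0`. -/
structure OrderedWord (Y Z : Type*) [LinearOrder Y] [LinearOrder Z] where
  even : List Y
  odd : List Z
  even_sorted : even.Pairwise (· ≤ ·)
  odd_sorted : odd.Pairwise (· < ·)
  ne_nil : 0 < even.length + odd.length

/-- The letters of the word, the even ones first. -/
def OrderedWord.letters {Y Z : Type*} [LinearOrder Y] [LinearOrder Z] (w : OrderedWord Y Z) :
    List (Y ⊕ Z) :=
  w.even.map Sum.inl ++ w.odd.map Sum.inr

/-- The family `X ∪ M`: the generators, and the monomials
`y₁(⋯(y_k(z₁(⋯(z_{l-1}((⋯(((⋯(z_l y_{k+1})⋯)y_{k+m})z_{l+1})⋯)z_{l+n}))⋯)))⋯)`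
given by two ordered nonempty words `y₁⋯y_k z₁⋯z_l` and `y_{k+1}⋯y_{k+m} z_{l+1}⋯z_{l+n}`. -/
noncomputable def basisFamily [LinearOrder Y] [LinearOrder Z] :
    (Y ⊕ Z) ⊕ (OrderedWord Y Z × OrderedWord Y Z) → FreeBicomm K Y Z
  | .inl x => FreeBicomm.gen K Y Z x
  | .inr (a, b) => bracket (a.letters.map (FreeBicomm.gen K Y Z))
      (b.letters.map (FreeBicomm.gen K Y Z))

/-! ### The free super-commutative associative algebra -/

/-- The defining relations `yx = xy` (`y ∈ Y`, `x ∈ Y ∪ Z`) and `z₂z₁ = -z₁z₂` (`z₁, z₂ ∈ Z`). -/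
inductive SuperCommRel : FreeAlgebra K (Y ⊕ Z) → FreeAlgebra K (Y ⊕ Z) → Prop
  | even (y : Y) (x : Y ⊕ Z) : SuperCommRel
      (FreeAlgebra.ι K (Sum.inl y) * FreeAlgebra.ι K x)
      (FreeAlgebra.ι K x * FreeAlgebra.ι K (Sum.inl y))
  | odd (z₁ z₂ : Z) : SuperCommRel
      (FreeAlgebra.ι K (Sum.inr z₂) * FreeAlgebra.ι K (Sum.inr z₁))
      (-(FreeAlgebra.ι K (Sum.inr z₁) * FreeAlgebra.ι K (Sum.inr z₂)))

/-- The free (unital, associative) super-commutative algebra generated by `Y` and `Z`. -/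
def FreeSuperComm : Type _ := RingQuot (SuperCommRel K Y Z)

namespace FreeSuperComm

noncomputable instance : Ring (FreeSuperComm K Y Z) :=
  inferInstanceAs (Ring (RingQuot (SuperCommRel K Y Z)))

noncomputable instance : Algebra K (FreeSuperComm K Y Z) :=
  inferInstanceAs (Algebra K (RingQuot (SuperCommRel K Y Z)))

/-- The quotient map from the free associative algebra. -/
noncomputable def mk : FreeAlgebra K (Y ⊕ Z) →ₐ[K] FreeSuperComm K Y Z :=
  RingQuot.mkAlgHom K (SuperCommRel K Y Z)

theorem mk_rel {a b : FreeAlgebra K (Y ⊕ Z)} (h : SuperCommRel K Y Z a b) :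
    mk K Y Z a = mk K Y Z b :=
  RingQuot.mkAlgHom_rel K h

/-- The generators. -/
noncomputable def gen (x : Y ⊕ Z) : FreeSuperComm K Y Z :=
  mk K Y Z (FreeAlgebra.ι K x)

theorem gen_even_mul (y : Y) (x : Y ⊕ Z) :
    gen K Y Z (.inl y) * gen K Y Z x = gen K Y Z x * gen K Y Z (.inl y) := by
  simpa [gen] using mk_rel K Y Z (SuperCommRel.even y x)

theorem gen_odd_mul (z₁ z₂ : Z) :
    gen K Y Z (.inr z₂) * gen K Y Z (.inr z₁) = -(gen K Y Z (.inr z₁) * gen K Y Z (.inr z₂)) := by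
  simpa [gen] using mk_rel K Y Z (SuperCommRel.odd z₁ z₂)

variable {K Y Z} in
/-- The homomorphism to an associative algebra given by images of the generators. -/
noncomputable def lift {B : Type*} [Ring B] [Algebra K B] (f : Y ⊕ Z → B)
    (h₀ : ∀ y x, f (.inl y) * f x = f x * f (.inl y))
    (h₁ : ∀ z₁ z₂, f (.inr z₂) * f (.inr z₁) = -(f (.inr z₁) * f (.inr z₂))) :
    FreeSuperComm K Y Z →ₐ[K] B :=
  RingQuot.liftAlgHom K ⟨FreeAlgebra.lift K f, by
    rintro _ _ (⟨y, x⟩ | ⟨z₁, z₂⟩)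
    · simpa using h₀ y x
    · simpa using h₁ z₁ z₂⟩

variable {K Y Z} in
@[simp]
theorem lift_gen {B : Type*} [Ring B] [Algebra K B] (f : Y ⊕ Z → B) (h₀) (h₁) (x : Y ⊕ Z) :
    lift (K := K) f h₀ h₁ (gen K Y Z x) = f x := by
  exact (RingQuot.liftAlgHom_mkAlgHom_apply K _ _ _).trans (by simp)

/-- The components of the grading: spanned by the products of generators of the given parity. -/
noncomputable def grading (i : ZMod 2) : Submodule K (FreeSuperComm K Y Z) :=
  Submodule.span K {s | ∃ w : List (Y ⊕ Z),
    (w.map genParity).sum = i ∧ s = (w.map (gen K Y Z)).prod}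

theorem gen_mem_grading (x : Y ⊕ Z) : gen K Y Z x ∈ grading K Y Z (genParity x) :=
  Submodule.subset_span ⟨[x], by simp, by simp⟩

instance : SetLike.GradedMonoid (grading K Y Z) where
  one_mem := Submodule.subset_span ⟨[], by simp, by simp⟩
  mul_mem i j a b ha hb := by
    have h := Submodule.mul_mem_mul ha hb
    rw [grading, grading, Submodule.span_mul_span] at h
    refine Submodule.span_mono ?_ h
    rintro _ ⟨_, ⟨v, hv, rfl⟩, _, ⟨w, hw, rfl⟩, rfl⟩
    exact ⟨v ++ w, by simp [hv, hw], by simp⟩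

/-- The decomposition of an element into its homogeneous components. -/
noncomputable def decomposeHom : FreeSuperComm K Y Z →ₐ[K] ⨁ i, grading K Y Z i :=
  lift (fun x => DirectSum.of (fun i => grading K Y Z i) (genParity x)
      ⟨gen K Y Z x, gen_mem_grading K Y Z x⟩)
    (fun y x => by
      rw [DirectSum.of_mul_of, DirectSum.of_mul_of]
      exact DirectSum.of_eq_of_gradedMonoid_eq
        (Sigma.subtype_ext (add_comm _ _) (gen_even_mul K Y Z y x)))
    (fun z₁ z₂ => by
      rw [DirectSum.of_mul_of, DirectSum.of_mul_of, ← map_neg]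
      exact congrArg _ (Subtype.ext (gen_odd_mul K Y Z z₁ z₂)))

theorem algHom_ext {B : Type*} [Semiring B] [Algebra K B] {f g : FreeSuperComm K Y Z →ₐ[K] B}
    (h : ∀ x, f (gen K Y Z x) = g (gen K Y Z x)) : f = g := by
  refine RingQuot.ringQuot_ext' (S := K) (s := SuperCommRel K Y Z) f g ?_
  ext x
  exact h x

noncomputable instance : GradedAlgebra (grading K Y Z) :=
  GradedAlgebra.ofAlgHom (grading K Y Z) (decomposeHom K Y Z)
    (by
      apply algHom_ext
      intro x
      simp [decomposeHom])
    (by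
      rintro i ⟨x, hx⟩
      simp only
      induction hx using Submodule.span_induction with
      | mem x h =>
        obtain ⟨w, rfl, rfl⟩ := h
        induction w with
        | nil => exact map_one (decomposeHom K Y Z)
        | cons a w ih =>
          simp only [List.map_cons, List.prod_cons, map_mul]
          rw [ih, decomposeHom, lift_gen, DirectSum.of_mul_of]
          exact DirectSum.of_eq_of_gradedMonoid_eq (Sigma.subtype_ext rfl rfl)
      | zero => rw [map_zero]; exact (map_zero (DirectSum.of (fun i => grading K Y Z i) i)).symm
      | add x y hx hy ihx ihy => rw [map_add, ihx, ihy, ← map_add]; rfl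
      | smul r x hx ih =>
        rw [map_smul, ih, ← DirectSum.lof_eq_of K, ← map_smul]; rfl)

/-- The augmentation: the homomorphism to `K` that sends every generator to `0`. -/
noncomputable def augmentation : FreeSuperComm K Y Z →ₐ[K] K :=
  lift (fun _ => 0) (by simp) (by simp)

/-- The augmentation ideal, as a nonunital algebra. -/
noncomputable def omega : NonUnitalSubalgebra K (FreeSuperComm K Y Z) where
  __ := LinearMap.ker (augmentation K Y Z).toLinearMap
  mul_mem' := by
    intro a b ha hb
    simp_all

theorem mem_omega {s : FreeSuperComm K Y Z} : s ∈ omega K Y Z ↔ augmentation K Y Z s = 0 :=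
  Iff.rfl

theorem gen_mem_omega (x : Y ⊕ Z) : gen K Y Z x ∈ omega K Y Z := by
  simp [mem_omega, augmentation]

theorem proj_mem_omega (i : ZMod 2) {s : FreeSuperComm K Y Z} (hs : s ∈ omega K Y Z) :
    GradedAlgebra.proj (grading K Y Z) i s ∈ omega K Y Z := by
  have h1 : ∀ t ∈ grading K Y Z 1, augmentation K Y Z t = 0 := by
    intro t ht
    induction ht using Submodule.span_induction with
    | mem x h =>
      obtain ⟨w, hw, rfl⟩ := h
      cases w with
      | nil => simp at hw
      | cons a w => simp [augmentation]
    | zero => simp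
    | add x y _ _ hx hy => simp [hx, hy]
    | smul r x _ hx => simp [hx]
  have hsum : GradedAlgebra.proj (grading K Y Z) 0 s + GradedAlgebra.proj (grading K Y Z) 1 s
      = s := by
    classical
    have := DirectSum.sum_support_decompose (grading K Y Z) s
    rw [Finset.sum_subset (Finset.subset_univ _)] at this
    · exact (Fin.sum_univ_two _).symm.trans this
    · intro j _ hj
      simpa using hj
  have hodd : augmentation K Y Z (GradedAlgebra.proj (grading K Y Z) 1 s) = 0 :=
    h1 _ (by simp)
  have heven : augmentation K Y Z (GradedAlgebra.proj (grading K Y Z) 0 s) = 0 := by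
    have h := congrArg (augmentation K Y Z) hsum
    rw [map_add, hodd, add_zero, (mem_omega K Y Z).1 hs] at h
    exact h
  rw [mem_omega]
  fin_cases i
  · exact heven
  · exact hodd

/-- The projection of the augmentation ideal to its component of parity `i`. -/
noncomputable def omegaProj (i : ZMod 2) : omega K Y Z →ₗ[K] omega K Y Z :=
  (GradedAlgebra.proj (grading K Y Z) i).restrict
    (p := (omega K Y Z).toSubmodule) (q := (omega K Y Z).toSubmodule)
    (fun _ hs => proj_mem_omega K Y Z i hs)

/-- The generators, as elements of the augmentation ideal. -/
noncomputable def omegaGen (x : Y ⊕ Z) : omega K Y Z := ⟨gen K Y Z x, gen_mem_omega K Y Z x⟩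

end FreeSuperComm

/-! ### The superalgebra `G(X) = KX ⊕ ω ⊗ ω` -/

/-- The vector space `KX ⊕ ω ⊗ ω`, where `X = Y ∪ Z` and `ω` is the augmentation ideal of the free
super-commutative algebra. -/
def GSup : Type _ :=
  ((Y ⊕ Z) →₀ K) × (FreeSuperComm.omega K Y Z ⊗[K] FreeSuperComm.omega K Y Z)

namespace GSup

open FreeSuperComm

noncomputable instance : AddCommGroup (GSup K Y Z) :=
  inferInstanceAs (AddCommGroup (((Y ⊕ Z) →₀ K) × (omega K Y Z ⊗[K] omega K Y Z)))

noncomputable instance : Module K (GSup K Y Z) :=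
  inferInstanceAs (Module K (((Y ⊕ Z) →₀ K) × (omega K Y Z ⊗[K] omega K Y Z)))

/-- The generator `x` of `G(X)`. -/
noncomputable def gen (x : Y ⊕ Z) : GSup K Y Z := (Finsupp.single x 1, 0)

/-- The inclusion of `ω ⊗ ω` in `G(X)`. -/
noncomputable def tensor : omega K Y Z ⊗[K] omega K Y Z →ₗ[K] GSup K Y Z :=
  LinearMap.inr K ((Y ⊕ Z) →₀ K) (omega K Y Z ⊗[K] omega K Y Z)

/-- The linear map `KX → ω` that is the identity on the generators. -/
noncomputable def toOmega : ((Y ⊕ Z) →₀ K) →ₗ[K] omega K Y Z :=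
  Finsupp.linearCombination K (omegaGen K Y Z)

/-- The signed product on `ω ⊗ ω`, the bilinear map with
`(u₁ ⊗ v₁, u₂ ⊗ v₂) ↦ (-1)^{|v₁|(|u₂| + |v₂|)} u₁u₂ ⊗ v₂v₁` on homogeneous elements: the sum, over
all parities `i`, `j`, `k`, of this product of the components `v₁`, `u₂`, `v₂` of parities `i`, `j`,
`k`. -/
noncomputable def signedMul : omega K Y Z ⊗[K] omega K Y Z →ₗ[K]
    omega K Y Z ⊗[K] omega K Y Z →ₗ[K] omega K Y Z ⊗[K] omega K Y Z :=
  ∑ i : ZMod 2, ∑ j : ZMod 2, ∑ k : ZMod 2, koszulSign i (j + k) •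
    TensorProduct.map₂
      ((LinearMap.mul K (omega K Y Z)).compl₂ (omegaProj K Y Z j))
      ((LinearMap.mul K (omega K Y Z)).flip.compl₁₂ (omegaProj K Y Z i) (omegaProj K Y Z k))

/-- The multiplication of `G(X)`, with values in `ω ⊗ ω`, on `KX ⊕ ω ⊗ ω`. The four terms are
`x ∘ x' = x ⊗ x'`, `x ∘ (u ⊗ v) = xu ⊗ v`, `(u ⊗ v) ∘ x = u ⊗ vx`, and the signed product. -/
noncomputable instance : Mul (GSup K Y Z) where
  mul a b := tensor K Y Z
    (toOmega K Y Z a.1 ⊗ₜ[K] toOmega K Y Z b.1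
      + (LinearMap.mulLeft K (toOmega K Y Z a.1)).rTensor (omega K Y Z) b.2
      + (LinearMap.mulRight K (toOmega K Y Z b.1)).lTensor (omega K Y Z) a.2
      + signedMul K Y Z a.2 b.2)

theorem mul_def (a b : GSup K Y Z) : a * b = tensor K Y Z
    (toOmega K Y Z a.1 ⊗ₜ[K] toOmega K Y Z b.1
      + (LinearMap.mulLeft K (toOmega K Y Z a.1)).rTensor (omega K Y Z) b.2
      + (LinearMap.mulRight K (toOmega K Y Z b.1)).lTensor (omega K Y Z) a.2
      + signedMul K Y Z a.2 b.2) := rfl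

noncomputable instance : NonUnitalNonAssocRing (GSup K Y Z) where
  left_distrib a b c := by
    have h1 : (b + c).1 = b.1 + c.1 := rfl
    have h2 : (b + c).2 = b.2 + c.2 := rfl
    have h3 (u v : omega K Y Z) :
        LinearMap.mulRight K (u + v) = LinearMap.mulRight K u + LinearMap.mulRight K v :=
      LinearMap.ext fun x => mul_add x u v
    rw [mul_def, mul_def, mul_def, ← map_add (tensor K Y Z), h1, h2]
    congr 1
    rw [map_add (toOmega K Y Z), h3, LinearMap.lTensor_add, LinearMap.add_apply,
      TensorProduct.tmul_add, map_add, map_add]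
    abel
  right_distrib a b c := by
    have h1 : (a + b).1 = a.1 + b.1 := rfl
    have h2 : (a + b).2 = a.2 + b.2 := rfl
    have h3 (u v : omega K Y Z) :
        LinearMap.mulLeft K (u + v) = LinearMap.mulLeft K u + LinearMap.mulLeft K v :=
      LinearMap.ext fun x => add_mul u v x
    rw [mul_def, mul_def, mul_def, ← map_add (tensor K Y Z), h1, h2]
    congr 1
    rw [map_add (toOmega K Y Z), h3, LinearMap.rTensor_add, LinearMap.add_apply,
      TensorProduct.add_tmul, map_add, map_add, LinearMap.add_apply]
    abel
  zero_mul a := by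
    have h1 : (0 : GSup K Y Z).1 = 0 := rfl
    have h2 : (0 : GSup K Y Z).2 = 0 := rfl
    have h3 : LinearMap.mulLeft K (0 : omega K Y Z) = 0 := LinearMap.ext fun u => zero_mul u
    rw [mul_def, h1, h2, map_zero (toOmega K Y Z), h3, TensorProduct.zero_tmul,
      LinearMap.rTensor_zero, LinearMap.zero_apply, map_zero, map_zero, LinearMap.zero_apply,
      add_zero, add_zero, add_zero, map_zero]
  mul_zero a := by
    have h1 : (0 : GSup K Y Z).1 = 0 := rfl
    have h2 : (0 : GSup K Y Z).2 = 0 := rfl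
    have h3 : LinearMap.mulRight K (0 : omega K Y Z) = 0 := LinearMap.ext fun u => mul_zero u
    rw [mul_def, h1, h2, map_zero (toOmega K Y Z), h3, TensorProduct.tmul_zero,
      LinearMap.lTensor_zero, LinearMap.zero_apply, map_zero, map_zero,
      add_zero, add_zero, add_zero, map_zero]

/-- The even and the odd component: the parity of `u ⊗ v` is the sum of the parities of `u`
and `v`. -/
noncomputable def grading (i : ZMod 2) : Submodule K (GSup K Y Z) :=
  Submodule.span K
    ({g | ∃ x : Y ⊕ Z, genParity x = i ∧ g = gen K Y Z x} ∪
      {g | ∃ (j k : ZMod 2) (u v : omega K Y Z), j + k = i ∧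
        (u : FreeSuperComm K Y Z) ∈ FreeSuperComm.grading K Y Z j ∧
        (v : FreeSuperComm K Y Z) ∈ FreeSuperComm.grading K Y Z k ∧
        g = tensor K Y Z (u ⊗ₜ[K] v)})

/-! The multiplication rules of `G(X)`. -/

theorem toOmega_gen (x : Y ⊕ Z) : toOmega K Y Z (gen K Y Z x).1 = omegaGen K Y Z x := by
  simp [toOmega, gen]

theorem gen_mul_gen (x x' : Y ⊕ Z) : gen K Y Z x * gen K Y Z x' =
    tensor K Y Z (omegaGen K Y Z x ⊗ₜ omegaGen K Y Z x') := by
  have h (x : Y ⊕ Z) : (gen K Y Z x).2 = 0 := rfl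
  simp [mul_def, toOmega_gen, h]

theorem gen_mul_tensor (x : Y ⊕ Z) (u v : omega K Y Z) :
    gen K Y Z x * tensor K Y Z (u ⊗ₜ v) = tensor K Y Z ((omegaGen K Y Z x * u) ⊗ₜ v) := by
  have h : (gen K Y Z x).2 = 0 := rfl
  have h1 : (tensor K Y Z (u ⊗ₜ v)).1 = 0 := rfl
  have h2 : (tensor K Y Z (u ⊗ₜ v)).2 = u ⊗ₜ v := rfl
  simp [mul_def, toOmega_gen, h, h1, h2]

theorem tensor_mul_gen (x : Y ⊕ Z) (u v : omega K Y Z) :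
    tensor K Y Z (u ⊗ₜ v) * gen K Y Z x = tensor K Y Z (u ⊗ₜ (v * omegaGen K Y Z x)) := by
  have h : (gen K Y Z x).2 = 0 := rfl
  have h1 : (tensor K Y Z (u ⊗ₜ v)).1 = 0 := rfl
  have h2 : (tensor K Y Z (u ⊗ₜ v)).2 = u ⊗ₜ v := rfl
  simp [mul_def, toOmega_gen, h, h1, h2]

theorem omegaProj_of_mem {i j : ZMod 2} {u : omega K Y Z}
    (hu : (u : FreeSuperComm K Y Z) ∈ FreeSuperComm.grading K Y Z j) :
    omegaProj K Y Z i u = if i = j then u else 0 := by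
  apply Subtype.ext
  change GradedAlgebra.proj (FreeSuperComm.grading K Y Z) i (u : FreeSuperComm K Y Z) = _
  rw [GradedAlgebra.proj_apply]
  split_ifs with h
  · subst h
    exact DirectSum.decompose_of_mem_same _ hu
  · exact DirectSum.decompose_of_mem_ne _ hu (Ne.symm h)

theorem tensor_mul_tensor {i j k : ZMod 2} (u₁ v₁ u₂ v₂ : omega K Y Z)
    (hv₁ : (v₁ : FreeSuperComm K Y Z) ∈ FreeSuperComm.grading K Y Z i)
    (hu₂ : (u₂ : FreeSuperComm K Y Z) ∈ FreeSuperComm.grading K Y Z j)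
    (hv₂ : (v₂ : FreeSuperComm K Y Z) ∈ FreeSuperComm.grading K Y Z k) :
    tensor K Y Z (u₁ ⊗ₜ v₁) * tensor K Y Z (u₂ ⊗ₜ v₂) =
      koszulSign i (j + k) • tensor K Y Z ((u₁ * u₂) ⊗ₜ (v₂ * v₁)) := by
  have h1 (u v : omega K Y Z) : (tensor K Y Z (u ⊗ₜ v)).1 = 0 := rfl
  have h2 (u v : omega K Y Z) : (tensor K Y Z (u ⊗ₜ v)).2 = u ⊗ₜ v := rfl
  have h3 : signedMul K Y Z (u₁ ⊗ₜ v₁) (u₂ ⊗ₜ v₂) =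
      koszulSign i (j + k) • ((u₁ * u₂) ⊗ₜ (v₂ * v₁)) := by
    have h : signedMul K Y Z (u₁ ⊗ₜ v₁) (u₂ ⊗ₜ v₂) =
        ∑ i' : ZMod 2, ∑ j' : ZMod 2, ∑ k' : ZMod 2, koszulSign i' (j' + k') •
          ((u₁ * omegaProj K Y Z j' u₂) ⊗ₜ[K]
            (omegaProj K Y Z k' v₂ * omegaProj K Y Z i' v₁)) := by
      simp [signedMul]
    rw [h, Finset.sum_eq_single i, Finset.sum_eq_single j, Finset.sum_eq_single k]
    · simp [omegaProj_of_mem K Y Z hv₁, omegaProj_of_mem K Y Z hu₂, omegaProj_of_mem K Y Z hv₂]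
    · intro b _ hb
      simp [omegaProj_of_mem K Y Z hv₂, hb]
    · simp
    · intro b _ hb
      simp [omegaProj_of_mem K Y Z hu₂, hb]
    · simp
    · intro b _ hb
      simp [omegaProj_of_mem K Y Z hv₁, hb]
    · simp
  simp [mul_def, h1, h2, h3]

end GSup

end Generators

end BicommSuper

/-!
Write `F` for `FreeBicomm K Y Z`, `S` for `FreeSuperComm K Y Z` and `G` for `GSup K Y Z`.

In a bicommutative superalgebra `A` an element `w` of the square `A²` associates with all elements
around it, `(aw)r = a(wr)`, and products of products super-commute; both follow by applying the
two identities alternately (`mul_mul_mul_assoc`, `mul_mul_mul_comm`). Homogeneous elements of `A²`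
are sums of homogeneous products (`mem_homogeneousProducts`), so `A²` is an associative
super-commutative superalgebra.

A map from the generators extends to `F` as soon as the target satisfies the two identities on
graded pieces that are closed under multiplication (`exists_hom`); the sum of the pieces need not be
direct. Applied to `F` itself, this gives the endomorphism that changes the sign of the odd
generators. Its eigenspaces are the components of `F`, which are therefore independent in
characteristic different from `2`, and `F` is the free bicommutative superalgebra.

The algebra `G` satisfies the identities because its product comes from an associative
super-commutative algebra, the graded tensor square of `S`: there `a ∘ b = λ(a)ρ(b)`, where `λ` and
`ρ` are the inclusion on `ω ⊗ ω`, while `λ(x) = x ⊗ 1` and `ρ(x) = 1 ⊗ x`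
(`mul_mem_and_incl_mul`). Since `λ` and `ρ` agree on products, `a(bc) = λ(a)λ(b)ρ(c)` and
`(ab)c = λ(a)ρ(b)ρ(c)`. This yields a homomorphism `F → G`.

The nonempty ordered words form a basis of `ω`: they span because a permutation of the letters only
multiplies a word by a scalar and `z² = 0` for odd `z`, and they are independent because `S` acts
on the space spanned by pairs of a multiset in `Y` and a finite subset of `Z`, where they send
`(0, ∅)` to different basis vectors. Hence `X` and the tensors of two ordered words form a basis of
`G`, and it is the image of `X ∪ M`. So `X ∪ M` is independent. It spans `F`: the brackets of
arbitrary nonempty words span an ideal (`word_mul_mem_bracketSpan`), and a bracket depends only on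
the values of its two words in `S`, linearly in each, since `S` acts on `F` from the left and from
the right (`bracketSpan_le`). The homomorphism `F → G` takes a basis to a basis, hence is bijective.
-/

namespace BicommSuper

/-! ### The square of a bicommutative superalgebra -/

section Superalgebras

variable {K : Type*} [Field K] {A : Type*} [NonUnitalNonAssocRing A] [Module K A]
  {𝒜 : ZMod 2 → Submodule K A}

theorem koszulSign_zero_left (j : ZMod 2) : koszulSign 0 j = 1 := by
  revert j; decide

theorem koszulSign_one_one : koszulSign 1 1 = -1 := by decide

theorem koszulSign_comm (i j : ZMod 2) : koszulSign i j = koszulSign j i := by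
  revert i j; decide

theorem IsSuperalgebra.homogeneous_induction (h : IsSuperalgebra 𝒜) {p : A → Prop}
    (hom : ∀ i, ∀ a ∈ 𝒜 i, p a) (add : ∀ a b, p a → p b → p (a + b)) (a : A) : p a := by
  have ha : a ∈ ⨆ i, 𝒜 i := by
    rw [h.isInternal.submodule_iSup_eq_top]
    exact Submodule.mem_top
  exact Submodule.iSup_induction 𝒜 (motive := p) ha hom (hom 0 0 (zero_mem _)) add

theorem isInternal_iff_isCompl {V : Type*} [AddCommGroup V] [Module K V]
    (𝒱 : ZMod 2 → Submodule K V) : DirectSum.IsInternal 𝒱 ↔ IsCompl (𝒱 0) (𝒱 1) :=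
  DirectSum.isInternal_submodule_iff_isCompl 𝒱 (by decide)
    (Set.eq_univ_of_forall (by decide : ∀ i : ZMod 2, i = 0 ∨ i = 1)).symm

/-- The identity `(a(cd))r = a((cd)r)` for homogeneous elements: `c` is moved to the front, the
factor `r` next to it, and the two moves are undone in the other order; the four signs cancel. -/
theorem IsBicommutativeSuperalgebra.mul_mul_mul_assoc (h : IsBicommutativeSuperalgebra 𝒜)
    {i j k l : ZMod 2} {a c d r : A} (ha : a ∈ 𝒜 i) (hc : c ∈ 𝒜 j) (hd : d ∈ 𝒜 k)
    (hr : r ∈ 𝒜 l) : (a * (c * d)) * r = a * ((c * d) * r) := by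
  have hs : ∀ i j k l : ZMod 2, koszulSign i j * (koszulSign (i + k) l *
      (koszulSign (j + l) i * koszulSign l k)) = 1 := by decide
  rw [h.left_comm ha hc hd, smul_mul_assoc, h.right_comm hc (h.mul_mem ha hd) hr,
    h.left_comm (h.mul_mem hc hr) ha hd, h.right_comm hc hr hd, mul_smul_comm, smul_smul,
    smul_smul, smul_smul, mul_assoc, mul_assoc, hs, one_smul]

/-- Products of homogeneous elements super-commute: `c` and `d` are exchanged with the factors of
`ab` one at a time. -/
theorem IsBicommutativeSuperalgebra.mul_mul_mul_comm (h : IsBicommutativeSuperalgebra 𝒜)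
    {i j k l : ZMod 2} {a b c d : A} (ha : a ∈ 𝒜 i) (hb : b ∈ 𝒜 j) (hc : c ∈ 𝒜 k)
    (hd : d ∈ 𝒜 l) :
    (a * b) * (c * d) = koszulSign (i + j) (k + l) • ((c * d) * (a * b)) := by
  have hs : ∀ i j k l : ZMod 2, koszulSign j (k + l) * (koszulSign i k * (koszulSign (i + l) j *
      (koszulSign (k + j) i * (koszulSign j l * koszulSign i (k + l))))) =
        koszulSign (i + j) (k + l) := by decide
  rw [h.right_comm ha hb (h.mul_mem hc hd), h.left_comm ha hc hd, smul_mul_assoc,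
    h.right_comm hc (h.mul_mem ha hd) hb, h.left_comm (h.mul_mem hc hb) ha hd,
    h.right_comm hc hb hd, mul_smul_comm, h.left_comm ha (h.mul_mem hc hd) hb]
  simp only [smul_smul]
  rw [hs]

/-- The span of the products `ab` of homogeneous elements whose parities add up to `i`. -/
def homogeneousProducts (𝒜 : ZMod 2 → Submodule K A) (i : ZMod 2) : Submodule K A :=
  Submodule.span K {x | ∃ (j k : ZMod 2) (a b : A),
    j + k = i ∧ a ∈ 𝒜 j ∧ b ∈ 𝒜 k ∧ x = a * b}

theorem IsSuperalgebra.homogeneousProducts_le (h : IsSuperalgebra 𝒜) (i : ZMod 2) :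
    homogeneousProducts 𝒜 i ≤ 𝒜 i := by
  refine Submodule.span_le.2 ?_
  rintro _ ⟨j, k, a, b, rfl, ha, hb, rfl⟩
  exact h.mul_mem ha hb

theorem homogeneousProducts_le_square (i : ZMod 2) :
    homogeneousProducts 𝒜 i ≤ (square K A).toSubmodule := by
  refine Submodule.span_le.2 ?_
  rintro _ ⟨j, k, a, b, rfl, ha, hb, rfl⟩
  exact Submodule.subset_span ⟨a, b, rfl⟩

theorem IsSuperalgebra.square_le_sup (h : IsSuperalgebra 𝒜) :
    (square K A).toSubmodule ≤ homogeneousProducts 𝒜 0 ⊔ homogeneousProducts 𝒜 1 := by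
  change Submodule.span K {x : A | ∃ a b : A, x = a * b} ≤ _
  refine Submodule.span_le.2 ?_
  rintro _ ⟨a, b, rfl⟩
  rw [SetLike.mem_coe]
  induction a using h.homogeneous_induction with
  | add a a' ha ha' => rw [add_mul]; exact add_mem ha ha'
  | hom j a ha =>
    induction b using h.homogeneous_induction with
    | add b b' hb hb' => rw [mul_add]; exact add_mem hb hb'
    | hom k b hb =>
      have hab : a * b ∈ homogeneousProducts 𝒜 (j + k) :=
        Submodule.subset_span ⟨j, k, a, b, rfl, ha, hb, rfl⟩
      rcases (by decide : ∀ i : ZMod 2, i = 0 ∨ i = 1) (j + k) with hi | hi <;> rw [hi] at hab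
      · exact Submodule.mem_sup_left hab
      · exact Submodule.mem_sup_right hab

/-- A homogeneous element of the square is a sum of homogeneous products of its parity, since the
products of the other parity cancel. -/
theorem IsSuperalgebra.mem_homogeneousProducts (h : IsSuperalgebra 𝒜) {i : ZMod 2} {x : A}
    (hx : x ∈ square K A) (hi : x ∈ 𝒜 i) : x ∈ homogeneousProducts 𝒜 i := by
  have hd := ((isInternal_iff_isCompl 𝒜).1 h.isInternal).disjoint
  rw [Submodule.disjoint_def] at hd
  obtain ⟨p, hp, q, hq, rfl⟩ := Submodule.mem_sup.1 (h.square_le_sup hx)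
  have hp' := h.homogeneousProducts_le _ hp
  have hq' := h.homogeneousProducts_le _ hq
  rcases (by decide : ∀ i : ZMod 2, i = 0 ∨ i = 1) i with rfl | rfl
  · rw [hd q ((Submodule.add_mem_iff_right _ hp').1 hi) hq', add_zero]
    exact hp
  · rw [hd p hp' ((Submodule.add_mem_iff_left _ hq').1 hi), zero_add]
    exact hq

theorem IsSuperalgebra.square (h : IsSuperalgebra 𝒜) :
    IsSuperalgebra (inducedGrading 𝒜 (square K A)) where
  isInternal := by
    have hd := ((isInternal_iff_isCompl 𝒜).1 h.isInternal).disjoint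
    rw [isInternal_iff_isCompl]
    constructor
    · rw [Submodule.disjoint_def] at hd ⊢
      exact fun x hx hx' => Subtype.ext (hd _ hx hx')
    · rw [codisjoint_iff, eq_top_iff]
      rintro ⟨x, hx⟩ -
      obtain ⟨p, hp, q, hq, rfl⟩ := Submodule.mem_sup.1 (h.square_le_sup hx)
      exact Submodule.mem_sup.2 ⟨⟨p, homogeneousProducts_le_square _ hp⟩,
        h.homogeneousProducts_le _ hp, ⟨q, homogeneousProducts_le_square _ hq⟩,
        h.homogeneousProducts_le _ hq, rfl⟩
  mul_mem ha hb := h.mul_mem ha hb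

variable [IsScalarTower K A A] [SMulCommClass K A A]

/-- An element of the square associates with any two elements around it. -/
theorem IsBicommutativeSuperalgebra.mul_square_mul (h : IsBicommutativeSuperalgebra 𝒜)
    {w : A} (hw : w ∈ square K A) (a r : A) : (a * w) * r = a * (w * r) := by
  have key : ∀ a c d r : A, (a * (c * d)) * r = a * ((c * d) * r) := by
    intro a c d r
    induction a using h.homogeneous_induction with
    | add a a' ha ha' => simp only [add_mul, ha, ha']
    | hom i a ha =>
      induction c using h.homogeneous_induction with
      | add c c' hc hc' => simp only [mul_add, add_mul, hc, hc']
      | hom j c hc =>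
        induction d using h.homogeneous_induction with
        | add d d' hd hd' => simp only [mul_add, add_mul, hd, hd']
        | hom k d hd =>
          induction r using h.homogeneous_induction with
          | add r r' hr hr' => simp only [mul_add, hr, hr']
          | hom l r hr => exact h.mul_mul_mul_assoc ha hc hd hr
  change w ∈ Submodule.span K {x : A | ∃ a b : A, x = a * b} at hw
  induction hw using Submodule.span_induction with
  | mem x hx =>
    obtain ⟨c, d, rfl⟩ := hx
    exact key a c d r
  | zero => simp
  | add x y _ _ hx hy => simp only [mul_add, add_mul, hx, hy]
  | smul t x _ hx => simp only [smul_mul_assoc, mul_smul_comm, hx]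

theorem IsBicommutativeSuperalgebra.square_superCommutative
    (h : IsBicommutativeSuperalgebra 𝒜) :
    IsSuperCommutative (inducedGrading 𝒜 (BicommSuper.square K A)) := by
  rintro i j ⟨a, ha⟩ ⟨b, hb⟩ hai hbj
  refine Subtype.ext ?_
  change b * a = koszulSign i j • (a * b)
  replace hai := h.mem_homogeneousProducts ha hai
  replace hbj := h.mem_homogeneousProducts hb hbj
  induction hai using Submodule.span_induction with
  | zero => simp
  | add x y hx' hy' hx hy =>
    rw [mul_add, add_mul, smul_add, hx (homogeneousProducts_le_square _ hx'),
      hy (homogeneousProducts_le_square _ hy')]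
  | smul t x hx' hx =>
    rw [mul_smul_comm, smul_mul_assoc, hx (homogeneousProducts_le_square _ hx'), smul_comm]
  | mem x hx =>
    obtain ⟨k, l, c, d, rfl, hc, hd, rfl⟩ := hx
    induction hbj using Submodule.span_induction with
    | zero => simp
    | add x y hx' hy' hx hy =>
      rw [mul_add, add_mul, smul_add, hx (homogeneousProducts_le_square _ hx'),
        hy (homogeneousProducts_le_square _ hy')]
    | smul t x hx' hx =>
      rw [mul_smul_comm, smul_mul_assoc, hx (homogeneousProducts_le_square _ hx'), smul_comm]
    | mem x hx =>
      obtain ⟨k', l', c', d', rfl, hc', hd', rfl⟩ := hx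
      rw [h.mul_mul_mul_comm hc' hd' hc hd, koszulSign_comm]

end Superalgebras

/-! ### The universal property of `F` -/

section Identities

variable {K : Type*} [Field K] {A : Type*} [NonUnitalNonAssocRing A] [Module K A]

/-- The axioms of a bicommutative superalgebra without the directness of the sum of the homogeneous
components. These are all that is needed to extend a map from the generators, so the universal
property can be used before the gradings of `F` and `G` are known to be direct. -/
structure BicommIdentities (𝒜 : ZMod 2 → Submodule K A) : Prop where
  mul_mem : ∀ {i j : ZMod 2} {a b : A}, a ∈ 𝒜 i → b ∈ 𝒜 j → a * b ∈ 𝒜 (i + j)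
  left_comm : ∀ {i j k : ZMod 2} {a b c : A}, a ∈ 𝒜 i → b ∈ 𝒜 j → c ∈ 𝒜 k →
    a * (b * c) = koszulSign i j • (b * (a * c))
  right_comm : ∀ {i j k : ZMod 2} {a b c : A}, a ∈ 𝒜 i → b ∈ 𝒜 j → c ∈ 𝒜 k →
    (a * b) * c = koszulSign j k • ((a * c) * b)

theorem IsBicommutativeSuperalgebra.identities {𝒜 : ZMod 2 → Submodule K A}
    (h : IsBicommutativeSuperalgebra 𝒜) : BicommIdentities 𝒜 :=
  ⟨h.mul_mem, h.left_comm, h.right_comm⟩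

end Identities

section Free

variable {K : Type*} [Field K] {Y Z : Type*}

theorem nonAssocGrading_mul_mem {i j : ZMod 2} {a b : FreeNonUnitalNonAssocAlgebra K (Y ⊕ Z)}
    (ha : a ∈ nonAssocGrading K Y Z i) (hb : b ∈ nonAssocGrading K Y Z j) :
    a * b ∈ nonAssocGrading K Y Z (i + j) := by
  induction ha, hb using Submodule.span_induction₂ with
  | mem_mem x y hx hy =>
    obtain ⟨v, rfl, rfl⟩ := hx
    obtain ⟨w, rfl, rfl⟩ := hy
    exact Submodule.subset_span ⟨v * w, rfl, (map_mul _ v w).symm⟩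
  | zero_left y hy => rw [zero_mul]; exact zero_mem _
  | zero_right x hx => rw [mul_zero]; exact zero_mem _
  | add_left x y z _ _ _ hx hy => rw [add_mul]; exact add_mem hx hy
  | add_right x y z _ _ _ hx hy => rw [mul_add]; exact add_mem hx hy
  | smul_left t x y _ _ h => rw [smul_mul_assoc]; exact Submodule.smul_mem _ _ h
  | smul_right t x y _ _ h => rw [mul_smul_comm]; exact Submodule.smul_mem _ _ h

theorem lift_mem_of_mem_nonAssocGrading {A : Type*} [NonUnitalNonAssocRing A] [Module K A]
    [IsScalarTower K A A] [SMulCommClass K A A] {𝒜 : ZMod 2 → Submodule K A}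
    (h : BicommIdentities 𝒜) {f : Y ⊕ Z → A} (hf : ∀ x, f x ∈ 𝒜 (genParity x)) {i : ZMod 2}
    {a : FreeNonUnitalNonAssocAlgebra K (Y ⊕ Z)} (ha : a ∈ nonAssocGrading K Y Z i) :
    FreeNonUnitalNonAssocAlgebra.lift K f a ∈ 𝒜 i := by
  induction ha using Submodule.span_induction with
  | zero => rw [map_zero]; exact zero_mem _
  | add x y _ _ hx hy => rw [map_add]; exact add_mem hx hy
  | smul t x _ hx => rw [map_smul]; exact Submodule.smul_mem _ _ hx
  | mem x hx =>
    obtain ⟨w, rfl, rfl⟩ := hx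
    induction w with
    | ih1 x =>
      have hx := FreeNonUnitalNonAssocAlgebra.lift_of_apply K f x
      exact (congrArg (· ∈ 𝒜 (genParity x)) hx).mpr (hf x)
    | ih2 v w hv hw =>
      rw [map_mul, map_mul]
      exact h.mul_mem hv hw

namespace FreeBicomm

/-- The quotient map as a homomorphism of algebras. -/
noncomputable def mkHom : FreeNonUnitalNonAssocAlgebra K (Y ⊕ Z) →ₙₐ[K] FreeBicomm K Y Z where
  __ := mk K Y Z
  map_zero' := map_zero (mk K Y Z)
  map_mul' := mk_mul K Y Z

theorem hom_ext {A : Type*} [NonUnitalNonAssocRing A] [Module K A]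
    [IsScalarTower K A A] [SMulCommClass K A A] {φ ψ : FreeBicomm K Y Z →ₙₐ[K] A}
    (h : ∀ x, φ (gen K Y Z x) = ψ (gen K Y Z x)) : φ = ψ := by
  have hc : φ.comp mkHom = ψ.comp mkHom := FreeNonUnitalNonAssocAlgebra.hom_ext K h
  ext a
  obtain ⟨a, rfl⟩ := mk_surjective K Y Z a
  exact DFunLike.congr_fun hc a

/-- The existence part of the universal property. -/
theorem exists_hom {A : Type*} [NonUnitalNonAssocRing A] [Module K A]
    [IsScalarTower K A A] [SMulCommClass K A A] {𝒜 : ZMod 2 → Submodule K A}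
    (h : BicommIdentities 𝒜) (f : Y ⊕ Z → A) (hf : ∀ x, f x ∈ 𝒜 (genParity x)) :
    ∃ φ : FreeBicomm K Y Z →ₙₐ[K] A, (∀ x, φ (gen K Y Z x) = f x) ∧
      ∀ i, ∀ a ∈ grading K Y Z i, φ a ∈ 𝒜 i := by
  let F := FreeNonUnitalNonAssocAlgebra.lift K f
  have hF {i a} (ha : a ∈ nonAssocGrading K Y Z i) : F a ∈ 𝒜 i :=
    lift_mem_of_mem_nonAssocGrading h hf ha
  have hker : identityIdeal K Y Z ≤ LinearMap.ker (F : _ →ₗ[K] A) := by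
    refine sInf_le ⟨?_, ?_⟩
    · rintro _ (⟨ha, hb, hc⟩ | ⟨ha, hb, hc⟩)
      · change F _ = 0
        rw [map_sub, map_zsmul, map_mul, map_mul, map_mul, map_mul,
          h.left_comm (hF ha) (hF hb) (hF hc), sub_self]
      · change F _ = 0
        rw [map_sub, map_zsmul, map_mul, map_mul, map_mul, map_mul,
          h.right_comm (hF ha) (hF hb) (hF hc), sub_self]
    · intro a x (hx : F x = 0)
      constructor <;> change F _ = 0 <;> rw [map_mul, hx]
      · rw [mul_zero]
      · rw [zero_mul]
  let φ : FreeBicomm K Y Z →ₗ[K] A := (identityIdeal K Y Z).liftQ (F : _ →ₗ[K] A) hker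
  have hφ (a) : φ (mk K Y Z a) = F a := rfl
  refine ⟨{ φ with
    map_zero' := map_zero φ
    map_mul' := ?_ }, ?_, ?_⟩
  · intro a b
    obtain ⟨a, rfl⟩ := mk_surjective K Y Z a
    obtain ⟨b, rfl⟩ := mk_surjective K Y Z b
    exact map_mul F a b
  · exact FreeNonUnitalNonAssocAlgebra.lift_of_apply K f
  · rintro i _ ⟨a, ha, rfl⟩
    exact hF ha

theorem gen_mem_grading (x : Y ⊕ Z) : gen K Y Z x ∈ grading K Y Z (genParity x) :=
  ⟨_, Submodule.subset_span ⟨FreeMagma.of x, rfl, rfl⟩, rfl⟩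

theorem identities : BicommIdentities (grading K Y Z) where
  mul_mem := by
    rintro i j _ _ ⟨a, ha, rfl⟩ ⟨b, hb, rfl⟩
    exact ⟨a * b, nonAssocGrading_mul_mem ha hb, rfl⟩
  left_comm := by
    rintro i j k _ _ _ ⟨a, ha, rfl⟩ ⟨b, hb, rfl⟩ ⟨c, hc, rfl⟩
    have hmem : a * (b * c) - koszulSign i j • (b * (a * c)) ∈ identityIdeal K Y Z :=
      Submodule.mem_sInf.2 fun J hJ => hJ.1 _ (.left ha hb hc)
    have h0 := (Submodule.Quotient.mk_eq_zero _).2 hmem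
    change mk K Y Z _ = 0 at h0
    rwa [map_sub, map_zsmul, sub_eq_zero] at h0
  right_comm := by
    rintro i j k _ _ _ ⟨a, ha, rfl⟩ ⟨b, hb, rfl⟩ ⟨c, hc, rfl⟩
    have hmem : (a * b) * c - koszulSign j k • ((a * c) * b) ∈ identityIdeal K Y Z :=
      Submodule.mem_sInf.2 fun J hJ => hJ.1 _ (.right ha hb hc)
    have h0 := (Submodule.Quotient.mk_eq_zero _).2 hmem
    change mk K Y Z _ = 0 at h0
    rwa [map_sub, map_zsmul, sub_eq_zero] at h0

theorem grading_sup_eq_top : grading K Y Z 0 ⊔ grading K Y Z 1 = ⊤ := by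
  rw [grading, grading, ← Submodule.map_sup, eq_top_iff]
  rintro a -
  obtain ⟨a, rfl⟩ := mk_surjective K Y Z a
  refine Submodule.mem_map_of_mem ?_
  induction a using MonoidAlgebra.induction_linear with
  | zero => exact zero_mem _
  | add x y hx hy => exact add_mem hx hy
  | single w r =>
    have hw : MonoidAlgebra.ofMagma K (FreeMagma (Y ⊕ Z)) w ∈
        nonAssocGrading K Y Z (wordParity w) :=
      Submodule.subset_span ⟨w, rfl, rfl⟩
    have hr : MonoidAlgebra.single w r = r • MonoidAlgebra.ofMagma K (FreeMagma (Y ⊕ Z)) w := by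
      simp [MonoidAlgebra.ofMagma]
    rw [hr]
    refine Submodule.smul_mem _ _ ?_
    rcases (by decide : ∀ i : ZMod 2, i = 0 ∨ i = 1) (wordParity w) with hi | hi <;> rw [hi] at hw
    · exact Submodule.mem_sup_left hw
    · exact Submodule.mem_sup_right hw

/-- The endomorphism that multiplies the odd generators by `-1` acts on the homogeneous components
as `1` and `-1`. In characteristic different from `2` the components therefore meet in `0`. -/
theorem grading_disjoint (hK : ringChar K ≠ 2) :
    Disjoint (grading K Y Z 0) (grading K Y Z 1) := by
  obtain ⟨σ, hσ, -⟩ := exists_hom (identities (K := K) (Y := Y) (Z := Z))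
    (fun x => koszulSign (genParity x) 1 • gen K Y Z x)
    (fun x => zsmul_mem (gen_mem_grading x) _)
  have hmul : ∀ i j : ZMod 2, koszulSign i 1 * koszulSign j 1 = koszulSign (i + j) 1 := by decide
  have key : ∀ i, ∀ a ∈ grading K Y Z i, σ a = koszulSign i 1 • a := by
    rintro i _ ⟨a, ha, rfl⟩
    induction ha using Submodule.span_induction with
    | zero => simp
    | add x y _ _ hx hy => rw [map_add, map_add, hx, hy, smul_add]
    | smul t x _ hx => rw [map_smul, map_smul, hx, smul_comm]
    | mem x hx =>
      obtain ⟨w, rfl, rfl⟩ := hx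
      induction w with
      | ih1 x => exact hσ x
      | ih2 v w hv hw =>
        rw [map_mul, mk_mul, map_mul, hv, hw, smul_mul_smul_comm, hmul]
        rfl
  rw [Submodule.disjoint_def]
  intro a h0 h1
  have h := (key 0 a h0).symm.trans (key 1 a h1)
  rw [koszulSign_zero_left, koszulSign_one_one, one_smul, neg_smul, one_smul] at h
  have h2 : (2 : K) • a = 0 := by
    rw [two_smul]
    nth_rw 1 [h]
    exact neg_add_cancel a
  exact (smul_eq_zero.1 h2).resolve_left (Ring.two_ne_zero hK)

theorem isBicommutativeSuperalgebra (hK : ringChar K ≠ 2) :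
    IsBicommutativeSuperalgebra (grading K Y Z) where
  isInternal := (isInternal_iff_isCompl _).2
    ⟨grading_disjoint hK, codisjoint_iff.2 grading_sup_eq_top⟩
  mul_mem := identities.mul_mem
  left_comm := identities.left_comm
  right_comm := identities.right_comm

end FreeBicomm

end Free

/-! ### The free super-commutative algebra: words and their permutations -/

theorem OrderedWord.letters_ne_nil {Y Z : Type*} [LinearOrder Y] [LinearOrder Z]
    (w : OrderedWord Y Z) : w.letters ≠ [] := by
  have h := w.ne_nil
  rw [← List.length_pos_iff]
  simpa [OrderedWord.letters] using h

namespace FreeSuperComm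

variable {K : Type*} [Field K] {Y Z : Type*}

theorem gen_mul_gen (x x' : Y ⊕ Z) : gen K Y Z x * gen K Y Z x' =
    koszulSign (genParity x) (genParity x') • (gen K Y Z x' * gen K Y Z x) := by
  have h0 : ∀ i : ZMod 2, koszulSign i 0 = 1 := by decide
  rcases x with y | z
  · rw [gen_even_mul, genParity, koszulSign_zero_left, one_smul]
  · rcases x' with y | z'
    · rw [← gen_even_mul, genParity, genParity, h0, one_smul]
    · rw [gen_odd_mul, genParity, genParity, koszulSign_one_one, neg_smul, one_smul]

theorem gen_odd_mul_self (hK : ringChar K ≠ 2) (z : Z) :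
    gen K Y Z (.inr z) * gen K Y Z (.inr z) = 0 := by
  have h := gen_odd_mul K Y Z z z
  have h2 : (2 : K) • (gen K Y Z (.inr z) * gen K Y Z (.inr z)) = 0 := by
    rw [two_smul]
    nth_rw 1 [h]
    exact neg_add_cancel _
  exact (smul_eq_zero.1 h2).resolve_left (Ring.two_ne_zero hK)

/-- Permuting the letters of a word multiplies its value by a scalar. -/
theorem exists_smul_of_perm {l l' : List (Y ⊕ Z)} (h : l.Perm l') :
    ∃ c : K, (l.map (gen K Y Z)).prod = c • (l'.map (gen K Y Z)).prod := by
  induction h with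
  | nil => exact ⟨1, (one_smul K _).symm⟩
  | cons x _ ih =>
    obtain ⟨c, hc⟩ := ih
    exact ⟨c, by simp [hc]⟩
  | swap x y l =>
    refine ⟨(koszulSign (genParity y) (genParity x) : ℤ), ?_⟩
    simp only [List.map_cons, List.prod_cons]
    rw [← mul_assoc, gen_mul_gen y x, smul_mul_assoc, mul_assoc, Int.cast_smul_eq_zsmul]
  | trans _ _ ih ih' =>
    obtain ⟨c, hc⟩ := ih
    obtain ⟨c', hc'⟩ := ih'
    exact ⟨c * c', by rw [hc, hc', smul_smul]⟩

theorem prod_mem_omega {l : List (Y ⊕ Z)} (hl : l ≠ []) :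
    (l.map (gen K Y Z)).prod ∈ omega K Y Z := by
  obtain ⟨x, l, rfl⟩ := List.exists_cons_of_ne_nil hl
  rw [mem_omega, List.map_cons, List.prod_cons, map_mul,
    (mem_omega K Y Z).1 (gen_mem_omega K Y Z x), zero_mul]

variable (K) in
/-- The product of the letters of a nonempty word, an element of the augmentation ideal. -/
noncomputable def omegaProd (l : List (Y ⊕ Z)) (hl : l ≠ []) : omega K Y Z :=
  ⟨(l.map (gen K Y Z)).prod, prod_mem_omega hl⟩

/-- Homogeneous elements of the augmentation ideal are combinations of nonempty words of the same
parity. -/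
theorem mem_span_of_mem_omega {i : ZMod 2} {s : FreeSuperComm K Y Z} (hs : s ∈ grading K Y Z i)
    (h0 : s ∈ omega K Y Z) :
    s ∈ Submodule.span K {t | ∃ l : List (Y ⊕ Z), l ≠ [] ∧ (l.map genParity).sum = i ∧
      t = (l.map (gen K Y Z)).prod} := by
  have key : s - algebraMap K _ (augmentation K Y Z s) ∈ Submodule.span K
      {t | ∃ l : List (Y ⊕ Z), l ≠ [] ∧ (l.map genParity).sum = i ∧
        t = (l.map (gen K Y Z)).prod} := by
    clear h0
    induction hs using Submodule.span_induction with
    | zero => simp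
    | add x y _ _ hx hy =>
      rw [map_add, map_add, add_sub_add_comm]
      exact add_mem hx hy
    | smul c x _ hx =>
      rw [map_smul, smul_eq_mul, map_mul, ← Algebra.smul_def, ← smul_sub]
      exact Submodule.smul_mem _ _ hx
    | mem x hx =>
      obtain ⟨l, hl, rfl⟩ := hx
      rcases eq_or_ne l [] with rfl | hne
      · simp
      · rw [(mem_omega K Y Z).1 (prod_mem_omega hne), map_zero, sub_zero]
        exact Submodule.subset_span ⟨l, hne, hl, rfl⟩
  rwa [(mem_omega K Y Z).1 h0, map_zero, sub_zero] at key

/-! ### A faithful action of the free super-commutative algebra -/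

variable (K) in
/-- Multiplication by the even generator `y` on the space with basis the pairs of a multiset of even
generators and a finite set of odd generators. -/
noncomputable def actEven (y : Y) : Module.End K (Multiset Y × Finset Z →₀ K) :=
  Finsupp.lmapDomain K K fun p => (y ::ₘ p.1, p.2)

theorem actEven_single (y : Y) (m : Multiset Y) (T : Finset Z) :
    actEven K y (Finsupp.single (m, T) 1) = Finsupp.single (y ::ₘ m, T) 1 :=
  Finsupp.mapDomain_single

theorem actEven_comm_actEven (y y' : Y) :
    actEven K (Z := Z) y * actEven K y' = actEven K y' * actEven K y := by
  refine Finsupp.lhom_ext' fun p => LinearMap.ext_ring ?_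
  obtain ⟨m, T⟩ := p
  change actEven K y (actEven K y' (Finsupp.single (m, T) 1)) =
    actEven K y' (actEven K y (Finsupp.single (m, T) 1))
  simp only [actEven_single, Multiset.cons_swap]

variable [LinearOrder Z]

variable (K) in
/-- Left multiplication by the odd generator `z` on the space with basis the pairs of a multiset of
even generators and a finite set of odd generators: the sign is that of moving `z` past the smaller
elements of the set. -/
noncomputable def actOdd (z : Z) : Module.End K (Multiset Y × Finset Z →₀ K) :=
  Finsupp.linearCombination K fun p =>
    if z ∈ p.2 then 0 else (-1 : K) ^ (p.2.filter (· < z)).card •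
      Finsupp.single (p.1, insert z p.2) (1 : K)

theorem actOdd_single_of_mem (m : Multiset Y) {z : Z} {T : Finset Z} (hz : z ∈ T) :
    actOdd K z (Finsupp.single (m, T) 1) = 0 := by
  simp [actOdd, hz]

theorem actOdd_single_of_notMem (m : Multiset Y) {z : Z} {T : Finset Z} (hz : z ∉ T) :
    actOdd K z (Finsupp.single (m, T) 1) =
      (-1 : K) ^ (T.filter (· < z)).card • Finsupp.single (m, insert z T) (1 : K) := by
  simp [actOdd, hz]

theorem actOdd_anticomm_of_lt (m : Multiset Y) {z₁ z₂ : Z} (h : z₁ < z₂) {T : Finset Z}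
    (h₁ : z₁ ∉ T) (h₂ : z₂ ∉ T) :
    actOdd K z₂ (actOdd K z₁ (Finsupp.single (m, T) 1)) =
      -actOdd K z₁ (actOdd K z₂ (Finsupp.single (m, T) 1)) := by
  have h₁' : z₁ ∉ insert z₂ T := by simp [h₁, h.ne]
  have h₂' : z₂ ∉ insert z₁ T := by simp [h₂, h.ne']
  rw [actOdd_single_of_notMem m h₁, actOdd_single_of_notMem m h₂, map_smul, map_smul,
    actOdd_single_of_notMem m h₁', actOdd_single_of_notMem m h₂', Finset.filter_insert,
    Finset.filter_insert, if_pos h, if_neg h.not_gt, Finset.card_insert_of_notMem (by simp [h₁]),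
    Finset.insert_comm, smul_smul, smul_smul, ← neg_smul]
  congr 1
  ring

theorem actOdd_anticomm (z₁ z₂ : Z) :
    actOdd K (Y := Y) z₂ * actOdd K z₁ = -(actOdd K z₁ * actOdd K z₂) := by
  refine Finsupp.lhom_ext' fun p => LinearMap.ext_ring ?_
  obtain ⟨m, T⟩ := p
  change actOdd K z₂ (actOdd K z₁ (Finsupp.single (m, T) 1)) =
    -actOdd K z₁ (actOdd K z₂ (Finsupp.single (m, T) 1))
  have zero {z z' : Z} (hz : z' ∈ insert z T) :
      actOdd K z' (actOdd K z (Finsupp.single (m, T) 1)) = 0 := by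
    by_cases h : z ∈ T
    · rw [actOdd_single_of_mem m h, map_zero]
    · rw [actOdd_single_of_notMem m h, map_smul, actOdd_single_of_mem m hz, smul_zero]
  by_cases h₁ : z₁ ∈ T
  · rw [actOdd_single_of_mem m h₁, map_zero, zero (Finset.mem_insert_of_mem h₁), neg_zero]
  by_cases h₂ : z₂ ∈ T
  · rw [actOdd_single_of_mem m h₂, map_zero, zero (Finset.mem_insert_of_mem h₂), neg_zero]
  rcases lt_trichotomy z₁ z₂ with h | rfl | h
  · exact actOdd_anticomm_of_lt m h h₁ h₂
  · rw [zero (Finset.mem_insert_self _ _), neg_zero]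
  · rw [actOdd_anticomm_of_lt m h h₂ h₁, neg_neg]

theorem actEven_comm_actOdd (y : Y) (z : Z) :
    actEven K y * actOdd K z = actOdd K z * actEven K y := by
  refine Finsupp.lhom_ext' fun p => LinearMap.ext_ring ?_
  obtain ⟨m, T⟩ := p
  change actEven K y (actOdd K z (Finsupp.single (m, T) 1)) =
    actOdd K z (actEven K y (Finsupp.single (m, T) 1))
  by_cases h : z ∈ T
  · rw [actOdd_single_of_mem m h, map_zero, actEven_single, actOdd_single_of_mem _ h]
  · rw [actOdd_single_of_notMem m h, map_smul, actEven_single, actEven_single,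
      actOdd_single_of_notMem _ h]

variable (K Y Z) in
/-- The free super-commutative algebra acts on the space with basis the pairs of a multiset of even
generators and a finite set of odd generators. -/
noncomputable def act : FreeSuperComm K Y Z →ₐ[K] Module.End K (Multiset Y × Finset Z →₀ K) :=
  lift (Sum.elim (actEven K) (actOdd K))
    (by
      rintro y (y' | z)
      · exact actEven_comm_actEven y y'
      · exact actEven_comm_actOdd y z)
    actOdd_anticomm

theorem act_prod_odd {l : List Z} (hl : l.Pairwise (· < ·)) :
    act K Y Z ((l.map (gen K Y Z ∘ Sum.inr)).prod) (Finsupp.single (0, ∅) 1) =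
      Finsupp.single (0, l.toFinset) 1 := by
  induction l with
  | nil => simp
  | cons z l ih =>
    rw [List.pairwise_cons] at hl
    have hz : z ∉ l.toFinset := fun h => lt_irrefl z (hl.1 z (List.mem_toFinset.1 h))
    have hf : l.toFinset.filter (· < z) = ∅ :=
      Finset.filter_eq_empty_iff.2 fun t ht => (hl.1 t (List.mem_toFinset.1 ht)).not_gt
    have hg : act K Y Z (gen K Y Z (Sum.inr z)) = actOdd K z := lift_gen _ _ _ _
    rw [List.map_cons, List.prod_cons, map_mul, Module.End.mul_apply, ih hl.2, Function.comp_apply,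
      hg, actOdd_single_of_notMem 0 hz, hf, Finset.card_empty, pow_zero, one_smul,
      List.toFinset_cons]

/-! ### The basis of ordered words -/

variable [LinearOrder Y]

variable (K) in
/-- The product of the letters of an ordered word. -/
noncomputable def wordProd (w : OrderedWord Y Z) : FreeSuperComm K Y Z :=
  (w.letters.map (gen K Y Z)).prod

theorem prod_letters_mem_span (hK : ringChar K ≠ 2) {l : List (Y ⊕ Z)} (hl : l ≠ []) :
    (l.map (gen K Y Z)).prod ∈ Submodule.span K (Set.range (wordProd K (Y := Y) (Z := Z))) := by
  have single (x : Y ⊕ Z) :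
      gen K Y Z x ∈ Submodule.span K (Set.range (wordProd K (Y := Y) (Z := Z))) := by
    rcases x with y | z
    · exact Submodule.subset_span ⟨⟨[y], [], by simp, by simp, by simp⟩, by
        simp [wordProd, OrderedWord.letters]⟩
    · exact Submodule.subset_span ⟨⟨[], [z], by simp, by simp, by simp⟩, by
        simp [wordProd, OrderedWord.letters]⟩
  induction l with
  | nil => exact absurd rfl hl
  | cons x l ih =>
    rcases eq_or_ne l [] with rfl | hl'
    · simpa using single x
    rw [List.map_cons, List.prod_cons]
    refine Submodule.span_induction (p := fun s _ => gen K Y Z x * s ∈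
      Submodule.span K (Set.range (wordProd K (Y := Y) (Z := Z)))) ?_ ?_ ?_ ?_ (ih hl')
    · rintro _ ⟨w, rfl⟩
      -- an ordered word that is a permutation of `x` followed by `w`
      have of_perm (w' : OrderedWord Y Z) (h : (x :: w.letters).Perm w'.letters) :
          gen K Y Z x * wordProd K w ∈
            Submodule.span K (Set.range (wordProd K (Y := Y) (Z := Z))) := by
        obtain ⟨c, hc⟩ := exists_smul_of_perm (K := K) h
        rw [List.map_cons, List.prod_cons] at hc
        rw [wordProd, hc]
        exact Submodule.smul_mem _ _ (Submodule.subset_span ⟨w', rfl⟩)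
      rcases x with y | z
      · refine of_perm ⟨w.even.orderedInsert (· ≤ ·) y, w.odd,
          w.even_sorted.orderedInsert y _, w.odd_sorted, ?_⟩ ?_
        · rw [List.orderedInsert_length]; omega
        · exact ((List.perm_orderedInsert (· ≤ ·) y w.even).map Sum.inl).symm.append_right _
      · by_cases hz : z ∈ w.odd
        · obtain ⟨l', hl'⟩ : ∃ l', w.letters.Perm (Sum.inr z :: l') :=
            have ⟨s, t, hst⟩ := List.append_of_mem hz
            ⟨w.even.map Sum.inl ++ (s.map Sum.inr ++ t.map Sum.inr), by
              rw [OrderedWord.letters, hst, List.map_append, List.map_cons]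
              exact (List.Perm.append_left _ List.perm_middle).trans List.perm_middle⟩
          obtain ⟨c, hc⟩ := exists_smul_of_perm (K := K) hl'
          rw [wordProd, hc, List.map_cons, List.prod_cons, mul_smul_comm, ← mul_assoc,
            gen_odd_mul_self hK, zero_mul, smul_zero]
          exact zero_mem _
        · refine of_perm ⟨w.even, w.odd.orderedInsert (· ≤ ·) z, w.even_sorted, ?_, ?_⟩ ?_
          · have hs : (w.odd.orderedInsert (· ≤ ·) z).Pairwise (· ≤ ·) :=
              (w.odd_sorted.imp le_of_lt).orderedInsert z _
            have hn : (w.odd.orderedInsert (· ≤ ·) z).Nodup :=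
              (List.perm_orderedInsert (· ≤ ·) z w.odd).nodup_iff.2
                (List.nodup_cons.2 ⟨hz, w.odd_sorted.imp ne_of_lt⟩)
            exact hs.imp₂ (fun _ _ => lt_of_le_of_ne) hn
          · rw [List.orderedInsert_length]; omega
          · refine (List.perm_middle.symm).trans (List.Perm.append_left _ ?_)
            exact ((List.perm_orderedInsert (· ≤ ·) z w.odd).map Sum.inr).symm
    · rw [mul_zero]; exact zero_mem _
    · intro s t _ _ hs ht
      rw [mul_add]; exact add_mem hs ht
    · intro c s _ hs
      rw [mul_smul_comm]; exact Submodule.smul_mem _ _ hs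

theorem omega_le_span (hK : ringChar K ≠ 2) :
    (omega K Y Z).toSubmodule ≤ Submodule.span K (Set.range (wordProd K (Y := Y) (Z := Z))) := by
  intro s hs
  have hproj (i : ZMod 2) : GradedAlgebra.proj (grading K Y Z) i s ∈
      Submodule.span K (Set.range (wordProd K (Y := Y) (Z := Z))) := by
    refine Submodule.span_le.2 ?_ (mem_span_of_mem_omega (i := i) ?_ (proj_mem_omega K Y Z i hs))
    · rintro _ ⟨l, hl, -, rfl⟩
      exact prod_letters_mem_span hK hl
    · rw [GradedAlgebra.proj_apply]
      exact SetLike.coe_mem _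
  classical
  rw [← DirectSum.sum_support_decompose (grading K Y Z) s]
  exact sum_mem fun i _ => hproj i

theorem act_wordProd (w : OrderedWord Y Z) :
    act K Y Z (wordProd K w) (Finsupp.single (0, ∅) 1) =
      Finsupp.single ((w.even : Multiset Y), w.odd.toFinset) 1 := by
  rw [wordProd, OrderedWord.letters, List.map_append, List.prod_append, map_mul,
    Module.End.mul_apply, List.map_map, List.map_map, act_prod_odd w.odd_sorted]
  induction w.even with
  | nil => simp
  | cons y l ih =>
    have hg : act K Y Z (gen K Y Z (Sum.inl y)) = actEven K y := lift_gen _ _ _ _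
    rw [List.map_cons, List.prod_cons, map_mul, Module.End.mul_apply, ih, Function.comp_apply,
      hg, actEven_single, Multiset.cons_coe]

theorem linearIndependent_wordProd :
    LinearIndependent K (wordProd K (Y := Y) (Z := Z)) := by
  have hinj : Function.Injective
      (fun w : OrderedWord Y Z => ((w.even : Multiset Y), w.odd.toFinset)) := by
    rintro ⟨e, o, he, ho, _⟩ ⟨e', o', he', ho', _⟩ h
    simp only [Prod.mk.injEq, Multiset.coe_eq_coe] at h
    obtain rfl : e = e' := h.1.eq_of_pairwise' he he'
    obtain rfl : o = o' := (List.perm_of_nodup_nodup_toFinset_eq (ho.imp ne_of_lt)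
      (ho'.imp ne_of_lt) h.2).eq_of_pairwise' (ho.imp le_of_lt) (ho'.imp le_of_lt)
    rfl
  have hb := (Finsupp.basisSingleOne (R := K)
    (ι := Multiset Y × Finset Z)).linearIndependent.comp _ hinj
  refine LinearIndependent.of_comp
    ((LinearMap.applyₗ (Finsupp.single (0, ∅) 1)).comp (act K Y Z).toLinearMap) ?_
  convert hb using 1
  funext w
  exact (act_wordProd w).trans (by simp)

/-- The basis of the augmentation ideal given by the ordered words. -/
noncomputable def omegaBasis (hK : ringChar K ≠ 2) :
    Module.Basis (OrderedWord Y Z) K (omega K Y Z) :=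
  Module.Basis.mk (v := fun w : OrderedWord Y Z => omegaProd K w.letters w.letters_ne_nil)
    (LinearIndependent.of_comp (omega K Y Z).toSubmodule.subtype linearIndependent_wordProd)
    (by
      rintro ⟨s, hs⟩ -
      have h := omega_le_span hK hs
      have hr : Set.range (wordProd K (Y := Y) (Z := Z)) = (omega K Y Z).toSubmodule.subtype ''
          Set.range (fun w : OrderedWord Y Z => omegaProd K w.letters w.letters_ne_nil) := by
        rw [← Set.range_comp]
        rfl
      rw [hr, Submodule.span_image] at h
      obtain ⟨t, ht, rfl⟩ := h
      exact ht)

theorem omegaBasis_apply (hK : ringChar K ≠ 2) (w : OrderedWord Y Z) :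
    omegaBasis hK w = omegaProd K w.letters w.letters_ne_nil := by
  rw [omegaBasis, Module.Basis.mk_apply]

end FreeSuperComm

/-! ### Super-commutativity of the free super-commutative algebra -/

variable {K : Type*} [Field K] {Y Z : Type*}

namespace FreeSuperComm

theorem gen_mul_prod (x : Y ⊕ Z) (l : List (Y ⊕ Z)) :
    gen K Y Z x * (l.map (gen K Y Z)).prod =
      koszulSign (genParity x) (l.map genParity).sum •
        ((l.map (gen K Y Z)).prod * gen K Y Z x) := by
  have h0 : ∀ i : ZMod 2, koszulSign i 0 = 1 := by decide
  have hs : ∀ i j k : ZMod 2, koszulSign i j * koszulSign i k = koszulSign i (j + k) := by decide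
  induction l with
  | nil => simp [h0]
  | cons x' l ih =>
    rw [List.map_cons, List.map_cons, List.prod_cons, List.sum_cons, ← mul_assoc, gen_mul_gen x x',
      smul_mul_assoc, mul_assoc, ih, mul_smul_comm, smul_smul, hs, mul_assoc]

theorem prod_mul_prod (l l' : List (Y ⊕ Z)) :
    (l.map (gen K Y Z)).prod * (l'.map (gen K Y Z)).prod =
      koszulSign (l.map genParity).sum (l'.map genParity).sum •
        ((l'.map (gen K Y Z)).prod * (l.map (gen K Y Z)).prod) := by
  have hs : ∀ i j k : ZMod 2, koszulSign j k * koszulSign i k = koszulSign (i + j) k := by decide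
  induction l with
  | nil => simp [koszulSign_zero_left]
  | cons x l ih =>
    rw [List.map_cons, List.map_cons, List.prod_cons, List.sum_cons, mul_assoc, ih, mul_smul_comm,
      ← mul_assoc, gen_mul_prod, smul_mul_assoc, smul_smul, hs, mul_assoc]

theorem mul_superComm {i j : ZMod 2} {a b : FreeSuperComm K Y Z} (ha : a ∈ grading K Y Z i)
    (hb : b ∈ grading K Y Z j) : a * b = koszulSign i j • (b * a) := by
  induction ha, hb using Submodule.span_induction₂ with
  | mem_mem x y hx hy =>
    obtain ⟨l, rfl, rfl⟩ := hx
    obtain ⟨l', rfl, rfl⟩ := hy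
    exact prod_mul_prod l l'
  | zero_left y hy => simp
  | zero_right x hx => simp
  | add_left x y z _ _ _ hx hy => rw [add_mul, mul_add, hx, hy, smul_add]
  | add_right x y z _ _ _ hx hy => rw [add_mul, mul_add, hx, hy, smul_add]
  | smul_left t x y _ _ h => rw [smul_mul_assoc, mul_smul_comm, h, smul_comm]
  | smul_right t x y _ _ h => rw [smul_mul_assoc, mul_smul_comm, h, smul_comm]

end FreeSuperComm

/-! ### The graded tensor square of the free super-commutative algebra -/

variable (K Y Z) in
/-- The graded tensor square `S ⊗ S` of the free super-commutative algebra `S`, with the product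
`(u₁ ⊗ v₁)(u₂ ⊗ v₂) = (-1)^{|v₁||u₂|} u₁u₂ ⊗ v₁v₂`. -/
abbrev TensorSquare : Type _ := FreeSuperComm.grading K Y Z ᵍ⊗[K] FreeSuperComm.grading K Y Z

namespace TensorSquare

open FreeSuperComm

/-- The components of the grading of `S ⊗ S` by the sum of the parities of the factors. -/
noncomputable def grading (i : ZMod 2) : Submodule K (TensorSquare K Y Z) :=
  Submodule.span K {t | ∃ (j k : ZMod 2) (u v : FreeSuperComm K Y Z), j + k = i ∧
    u ∈ FreeSuperComm.grading K Y Z j ∧ v ∈ FreeSuperComm.grading K Y Z k ∧ t = u ᵍ⊗ₜ[K] v}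

theorem tmul_mem_grading {j k : ZMod 2} {u v : FreeSuperComm K Y Z}
    (hu : u ∈ FreeSuperComm.grading K Y Z j) (hv : v ∈ FreeSuperComm.grading K Y Z k) :
    (u ᵍ⊗ₜ[K] v : TensorSquare K Y Z) ∈ grading (j + k) :=
  Submodule.subset_span ⟨j, k, u, v, rfl, hu, hv, rfl⟩

theorem tmul_mul_tmul {i j : ZMod 2} (u₁ : FreeSuperComm K Y Z) {v₁ u₂ : FreeSuperComm K Y Z}
    (v₂ : FreeSuperComm K Y Z) (hv₁ : v₁ ∈ FreeSuperComm.grading K Y Z i)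
    (hu₂ : u₂ ∈ FreeSuperComm.grading K Y Z j) :
    (u₁ ᵍ⊗ₜ[K] v₁ * u₂ ᵍ⊗ₜ[K] v₂ : TensorSquare K Y Z) =
      koszulSign i j • ((u₁ * u₂) ᵍ⊗ₜ[K] (v₁ * v₂)) := by
  have hs : ∀ i j : ZMod 2, (((-1 : ℤˣ) ^ (i * j) : ℤˣ) : ℤ) = koszulSign i j := by decide
  have h := GradedTensorProduct.tmul_coe_mul_coe_tmul (R := K) (FreeSuperComm.grading K Y Z)
    (FreeSuperComm.grading K Y Z) u₁ ⟨v₁, hv₁⟩ ⟨u₂, hu₂⟩ v₂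
  rw [Units.smul_def, hs] at h
  exact h

theorem mul_superComm {i j : ZMod 2} {a b : TensorSquare K Y Z} (ha : a ∈ grading i)
    (hb : b ∈ grading j) : a * b = koszulSign i j • (b * a) := by
  induction ha, hb using Submodule.span_induction₂ with
  | mem_mem x y hx hy =>
    obtain ⟨i₁, i₂, u₁, v₁, rfl, hu₁, hv₁, rfl⟩ := hx
    obtain ⟨j₁, j₂, u₂, v₂, rfl, hu₂, hv₂, rfl⟩ := hy
    have hs : ∀ i₁ i₂ j₁ j₂ : ZMod 2, koszulSign i₂ j₁ * koszulSign i₂ j₂ * koszulSign i₁ j₁ =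
        koszulSign (i₁ + i₂) (j₁ + j₂) * koszulSign j₂ i₁ := by decide
    rw [tmul_mul_tmul u₁ v₂ hv₁ hu₂, tmul_mul_tmul u₂ v₁ hv₂ hu₁,
      FreeSuperComm.mul_superComm hu₁ hu₂, FreeSuperComm.mul_superComm hv₁ hv₂,
      GradedTensorProduct.tmul, GradedTensorProduct.tmul, TensorProduct.tmul_smul,
      ← TensorProduct.smul_tmul', map_zsmul, map_zsmul, smul_smul, smul_smul, smul_smul, hs]
  | zero_left y hy => simp
  | zero_right x hx => simp
  | add_left x y z _ _ _ hx hy => rw [add_mul, mul_add, hx, hy, smul_add]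
  | add_right x y z _ _ _ hx hy => rw [add_mul, mul_add, hx, hy, smul_add]
  | smul_left t x y _ _ h => rw [smul_mul_assoc, mul_smul_comm, h, smul_comm]
  | smul_right t x y _ _ h => rw [smul_mul_assoc, mul_smul_comm, h, smul_comm]

end TensorSquare

/-! ### The identities of `G(X)` -/

namespace GSup

open FreeSuperComm

instance : IsScalarTower K (GSup K Y Z) (GSup K Y Z) :=
  ⟨fun r a b => by
    have h1 : (r • a).1 = r • a.1 := rfl
    have h2 : (r • a).2 = r • a.2 := rfl
    have h3 (u : omega K Y Z) : LinearMap.mulLeft K (r • u) = r • LinearMap.mulLeft K u :=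
      LinearMap.ext fun v => smul_mul_assoc r u v
    rw [smul_eq_mul, smul_eq_mul, mul_def, mul_def, h1, h2, map_smul (toOmega K Y Z), h3,
      LinearMap.rTensor_smul, LinearMap.smul_apply, ← TensorProduct.smul_tmul', map_smul, map_smul,
      LinearMap.smul_apply, ← smul_add, ← smul_add, ← smul_add, map_smul]⟩

instance : SMulCommClass K (GSup K Y Z) (GSup K Y Z) :=
  ⟨fun r a b => by
    have h1 : (r • b).1 = r • b.1 := rfl
    have h2 : (r • b).2 = r • b.2 := rfl
    have h3 (u : omega K Y Z) : LinearMap.mulRight K (r • u) = r • LinearMap.mulRight K u :=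
      LinearMap.ext fun v => mul_smul_comm r v u
    rw [smul_eq_mul, smul_eq_mul, mul_def, mul_def, h1, h2, map_smul (toOmega K Y Z), h3,
      LinearMap.lTensor_smul, LinearMap.smul_apply, TensorProduct.tmul_smul, map_smul, map_smul,
      ← smul_add, ← smul_add, ← smul_add, map_smul]⟩

variable (K Y Z) in
/-- The inclusion of `ω ⊗ ω` in `S ⊗ S`. -/
noncomputable def incl : omega K Y Z ⊗[K] omega K Y Z →ₗ[K] TensorSquare K Y Z :=
  (GradedTensorProduct.of K (FreeSuperComm.grading K Y Z)
    (FreeSuperComm.grading K Y Z)).toLinearMap ∘ₗ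
      TensorProduct.map (omega K Y Z).toSubmodule.subtype (omega K Y Z).toSubmodule.subtype

theorem incl_injective : Function.Injective (incl K Y Z) :=
  (GradedTensorProduct.of K (FreeSuperComm.grading K Y Z)
    (FreeSuperComm.grading K Y Z)).injective.comp
      (TensorProduct.map_injective_of_flat_flat (omega K Y Z).toSubmodule.subtype
        (omega K Y Z).toSubmodule.subtype (Submodule.injective_subtype _)
        (Submodule.injective_subtype _))

theorem incl_tmul (u v : omega K Y Z) :
    incl K Y Z (u ⊗ₜ v) = (u : FreeSuperComm K Y Z) ᵍ⊗ₜ[K] (v : FreeSuperComm K Y Z) := rfl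

variable (K Y Z) in
/-- The linear map `G(X) → S ⊗ S` that is the inclusion on `ω ⊗ ω` and sends `x` to `x ⊗ 1`: the
role of an element of `G(X)` as a left factor. -/
noncomputable def leftFactor : GSup K Y Z →ₗ[K] TensorSquare K Y Z :=
  (Finsupp.linearCombination K fun x => FreeSuperComm.gen K Y Z x ᵍ⊗ₜ[K] 1).coprod (incl K Y Z)

variable (K Y Z) in
/-- The linear map `G(X) → S ⊗ S` that is the inclusion on `ω ⊗ ω` and sends `x` to `1 ⊗ x`: the
role of an element of `G(X)` as a right factor. -/
noncomputable def rightFactor : GSup K Y Z →ₗ[K] TensorSquare K Y Z :=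
  (Finsupp.linearCombination K fun x => 1 ᵍ⊗ₜ[K] FreeSuperComm.gen K Y Z x).coprod (incl K Y Z)

theorem leftFactor_gen (x : Y ⊕ Z) :
    leftFactor K Y Z (gen K Y Z x) = FreeSuperComm.gen K Y Z x ᵍ⊗ₜ[K] 1 := by
  change Finsupp.linearCombination K _ (Finsupp.single x 1) + incl K Y Z 0 = _
  rw [map_zero, add_zero, Finsupp.linearCombination_single, one_smul]

theorem rightFactor_gen (x : Y ⊕ Z) :
    rightFactor K Y Z (gen K Y Z x) = 1 ᵍ⊗ₜ[K] FreeSuperComm.gen K Y Z x := by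
  change Finsupp.linearCombination K _ (Finsupp.single x 1) + incl K Y Z 0 = _
  rw [map_zero, add_zero, Finsupp.linearCombination_single, one_smul]

theorem leftFactor_tensor (t : omega K Y Z ⊗[K] omega K Y Z) :
    leftFactor K Y Z (tensor K Y Z t) = incl K Y Z t := by
  change Finsupp.linearCombination K (fun x => FreeSuperComm.gen K Y Z x ᵍ⊗ₜ[K] 1) 0 +
    incl K Y Z t = _
  rw [map_zero, zero_add]

theorem rightFactor_tensor (t : omega K Y Z ⊗[K] omega K Y Z) :
    rightFactor K Y Z (tensor K Y Z t) = incl K Y Z t := by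
  change Finsupp.linearCombination K (fun x => 1 ᵍ⊗ₜ[K] FreeSuperComm.gen K Y Z x) 0 +
    incl K Y Z t = _
  rw [map_zero, zero_add]

theorem gen_mem_grading (x : Y ⊕ Z) : gen K Y Z x ∈ grading K Y Z (genParity x) :=
  Submodule.subset_span (Or.inl ⟨x, rfl, rfl⟩)

theorem tensor_mem_grading {j k : ZMod 2} {u v : omega K Y Z}
    (hu : (u : FreeSuperComm K Y Z) ∈ FreeSuperComm.grading K Y Z j)
    (hv : (v : FreeSuperComm K Y Z) ∈ FreeSuperComm.grading K Y Z k) :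
    tensor K Y Z (u ⊗ₜ v) ∈ grading K Y Z (j + k) :=
  Submodule.subset_span (Or.inr ⟨j, k, u, v, rfl, hu, hv, rfl⟩)

theorem leftFactor_mem {i : ZMod 2} {a : GSup K Y Z} (ha : a ∈ grading K Y Z i) :
    leftFactor K Y Z a ∈ TensorSquare.grading i := by
  refine Submodule.span_le (p := (TensorSquare.grading i).comap (leftFactor K Y Z)).2 ?_ ha
  rintro _ (⟨x, rfl, rfl⟩ | ⟨j, k, u, v, rfl, hu, hv, rfl⟩)
  · rw [SetLike.mem_coe, Submodule.mem_comap, leftFactor_gen]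
    simpa using TensorSquare.tmul_mem_grading (FreeSuperComm.gen_mem_grading K Y Z x)
      (SetLike.GradedOne.one_mem (A := FreeSuperComm.grading K Y Z))
  · rw [SetLike.mem_coe, Submodule.mem_comap, leftFactor_tensor]
    exact TensorSquare.tmul_mem_grading hu hv

theorem rightFactor_mem {i : ZMod 2} {a : GSup K Y Z} (ha : a ∈ grading K Y Z i) :
    rightFactor K Y Z a ∈ TensorSquare.grading i := by
  refine Submodule.span_le (p := (TensorSquare.grading i).comap (rightFactor K Y Z)).2 ?_ ha
  rintro _ (⟨x, rfl, rfl⟩ | ⟨j, k, u, v, rfl, hu, hv, rfl⟩)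
  · rw [SetLike.mem_coe, Submodule.mem_comap, rightFactor_gen]
    simpa using TensorSquare.tmul_mem_grading
      (SetLike.GradedOne.one_mem (A := FreeSuperComm.grading K Y Z))
      (FreeSuperComm.gen_mem_grading K Y Z x)
  · rw [SetLike.mem_coe, Submodule.mem_comap, rightFactor_tensor]
    exact TensorSquare.tmul_mem_grading hu hv

theorem tensor_snd_mul (a b : GSup K Y Z) : tensor K Y Z (a * b).2 = a * b := rfl

/-- Every product of `G(X)` is computed in `S ⊗ S`: it is the product of its factors in their left
and right roles. The sign in the product of `ω ⊗ ω` comes from super-commutativity, which turns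
`v₂v₁` into `v₁v₂`. -/
theorem mul_mem_and_incl_mul {i j : ZMod 2} {a b : GSup K Y Z} (ha : a ∈ grading K Y Z i)
    (hb : b ∈ grading K Y Z j) : a * b ∈ grading K Y Z (i + j) ∧
      leftFactor K Y Z (a * b) = leftFactor K Y Z a * rightFactor K Y Z b := by
  have h1 : (1 : FreeSuperComm K Y Z) ∈ FreeSuperComm.grading K Y Z 0 :=
    SetLike.GradedOne.one_mem (A := FreeSuperComm.grading K Y Z)
  have hmul {i j : ZMod 2} {u v : FreeSuperComm K Y Z} (hu : u ∈ FreeSuperComm.grading K Y Z i)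
      (hv : v ∈ FreeSuperComm.grading K Y Z j) : u * v ∈ FreeSuperComm.grading K Y Z (i + j) :=
    SetLike.GradedMul.mul_mem hu hv
  have h0 : ∀ i : ZMod 2, koszulSign i 0 = 1 := by decide
  induction ha, hb using Submodule.span_induction₂ with
  | mem_mem x y hx hy =>
    rcases hx with ⟨x, rfl, rfl⟩ | ⟨i₁, i₂, u₁, v₁, rfl, hu₁, hv₁, rfl⟩ <;>
      rcases hy with ⟨x', rfl, rfl⟩ | ⟨j₁, j₂, u₂, v₂, rfl, hu₂, hv₂, rfl⟩
    · rw [gen_mul_gen, leftFactor_tensor, leftFactor_gen, rightFactor_gen, incl_tmul,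
        TensorSquare.tmul_mul_tmul _ _ h1 h1, h0, one_smul, one_mul, mul_one]
      exact ⟨tensor_mem_grading (FreeSuperComm.gen_mem_grading K Y Z x)
        (FreeSuperComm.gen_mem_grading K Y Z x'), rfl⟩
    · rw [gen_mul_tensor, leftFactor_tensor, leftFactor_gen, rightFactor_tensor, incl_tmul,
        incl_tmul, TensorSquare.tmul_mul_tmul _ _ h1 hu₂, koszulSign_zero_left, one_smul, one_mul]
      refine ⟨?_, rfl⟩
      rw [← add_assoc]
      exact tensor_mem_grading (hmul (FreeSuperComm.gen_mem_grading K Y Z x) hu₂) hv₂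
    · rw [tensor_mul_gen, leftFactor_tensor, leftFactor_tensor, rightFactor_gen, incl_tmul,
        incl_tmul, TensorSquare.tmul_mul_tmul _ _ hv₁ h1, h0, one_smul, mul_one]
      refine ⟨?_, rfl⟩
      rw [add_assoc]
      exact tensor_mem_grading hu₁ (hmul hv₁ (FreeSuperComm.gen_mem_grading K Y Z x'))
    · have hs : ∀ i j k : ZMod 2, koszulSign i (j + k) * koszulSign k i = koszulSign i j := by
        decide
      have hp : ∀ i j k l : ZMod 2, i + j + (k + l) = i + k + (l + j) := by decide
      rw [tensor_mul_tensor K Y Z u₁ v₁ u₂ v₂ hv₁ hu₂ hv₂, map_zsmul, leftFactor_tensor,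
        leftFactor_tensor, rightFactor_tensor, incl_tmul, incl_tmul, incl_tmul,
        TensorSquare.tmul_mul_tmul _ _ hv₁ hu₂]
      refine ⟨?_, ?_⟩
      · rw [hp]
        exact zsmul_mem (tensor_mem_grading (hmul hu₁ hu₂) (hmul hv₂ hv₁)) _
      · change _ • (((u₁ : FreeSuperComm K Y Z) * u₂) ᵍ⊗ₜ[K]
          ((v₂ : FreeSuperComm K Y Z) * v₁)) = _
        rw [FreeSuperComm.mul_superComm hv₂ hv₁, GradedTensorProduct.tmul, TensorProduct.tmul_smul,
          map_zsmul, smul_smul, hs]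
  | zero_left y hy => simp
  | zero_right x hx => simp
  | add_left x y z _ _ _ hx hy =>
    rw [add_mul, map_add, map_add, add_mul, hx.2, hy.2]
    exact ⟨add_mem hx.1 hy.1, rfl⟩
  | add_right x y z _ _ _ hx hy =>
    rw [mul_add, map_add, map_add, mul_add, hx.2, hy.2]
    exact ⟨add_mem hx.1 hy.1, rfl⟩
  | smul_left t x y _ _ h =>
    rw [smul_mul_assoc, map_smul, map_smul, smul_mul_assoc, h.2]
    exact ⟨Submodule.smul_mem _ _ h.1, rfl⟩
  | smul_right t x y _ _ h =>
    rw [mul_smul_comm, map_smul, map_smul, mul_smul_comm, h.2]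
    exact ⟨Submodule.smul_mem _ _ h.1, rfl⟩

theorem rightFactor_mul (a b : GSup K Y Z) :
    rightFactor K Y Z (a * b) = leftFactor K Y Z (a * b) := by
  rw [← tensor_snd_mul, leftFactor_tensor, rightFactor_tensor]

theorem mul_ext {a b c d : GSup K Y Z}
    {n : ℤ} (h : leftFactor K Y Z (a * b) = n • leftFactor K Y Z (c * d)) :
    a * b = n • (c * d) := by
  rw [← tensor_snd_mul a b, ← tensor_snd_mul c d] at h ⊢
  rw [leftFactor_tensor, leftFactor_tensor, ← map_zsmul] at h
  rw [incl_injective h, map_zsmul]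

theorem identities : BicommIdentities (grading K Y Z) where
  mul_mem ha hb := (mul_mem_and_incl_mul ha hb).1
  left_comm ha hb hc := by
    have hbc := mul_mem_and_incl_mul hb hc
    have hac := mul_mem_and_incl_mul ha hc
    refine mul_ext ?_
    rw [(mul_mem_and_incl_mul ha hbc.1).2, (mul_mem_and_incl_mul hb hac.1).2, rightFactor_mul,
      rightFactor_mul, hbc.2, hac.2, ← mul_assoc,
      TensorSquare.mul_superComm (leftFactor_mem ha) (leftFactor_mem hb), smul_mul_assoc, mul_assoc]
  right_comm ha hb hc := by
    have hab := mul_mem_and_incl_mul ha hb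
    have hac := mul_mem_and_incl_mul ha hc
    refine mul_ext ?_
    rw [(mul_mem_and_incl_mul hab.1 hc).2, (mul_mem_and_incl_mul hac.1 hb).2, hab.2, hac.2,
      mul_assoc, TensorSquare.mul_superComm (rightFactor_mem hb) (rightFactor_mem hc),
      mul_smul_comm, mul_assoc]

end GSup

/-! ### Brackets in `F` and in `G(X)` -/

theorem bracket_cons {A : Type*} [Mul A] [Zero A] (x : A) {a : List A} (ha : a ≠ []) (b : List A) :
    bracket (x :: a) b = x * bracket a b := by
  cases a with
  | nil => exact absurd rfl ha
  | cons => rfl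

namespace FreeSuperComm

theorem omegaProd_cons (x : Y ⊕ Z) {l : List (Y ⊕ Z)} (hl : l ≠ []) :
    omegaProd K (x :: l) (List.cons_ne_nil x l) = omegaGen K Y Z x * omegaProd K l hl :=
  Subtype.ext (by simp [omegaProd, omegaGen])

theorem omegaProd_singleton (x : Y ⊕ Z) :
    omegaProd K [x] (List.cons_ne_nil x []) = omegaGen K Y Z x :=
  Subtype.ext (by simp [omegaProd, omegaGen])

theorem mem_span_omegaProd {i : ZMod 2} {u : omega K Y Z}
    (hu : (u : FreeSuperComm K Y Z) ∈ grading K Y Z i) :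
    u ∈ Submodule.span K {t | ∃ (l : List (Y ⊕ Z)) (hl : l ≠ []), (l.map genParity).sum = i ∧
      t = omegaProd K l hl} := by
  have h := mem_span_of_mem_omega hu u.2
  have hr : {t | ∃ l : List (Y ⊕ Z), l ≠ [] ∧ (l.map genParity).sum = i ∧
      t = (l.map (gen K Y Z)).prod} = (omega K Y Z).toSubmodule.subtype ''
        {t | ∃ (l : List (Y ⊕ Z)) (hl : l ≠ []), (l.map genParity).sum = i ∧
          t = omegaProd K l hl} := by
    ext t
    constructor
    · rintro ⟨l, hl, hi, rfl⟩
      exact ⟨_, ⟨l, hl, hi, rfl⟩, rfl⟩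
    · rintro ⟨_, ⟨l, hl, hi, rfl⟩, rfl⟩
      exact ⟨l, hl, hi, rfl⟩
  rw [hr, Submodule.span_image] at h
  obtain ⟨t, ht, htu⟩ := h
  rwa [← Subtype.ext htu]

end FreeSuperComm

namespace GSup

open FreeSuperComm

theorem foldl_tensor (u : omega K Y Z) (b : List (Y ⊕ Z)) (v v' : omega K Y Z)
    (h : (v' : FreeSuperComm K Y Z) = v * (b.map (FreeSuperComm.gen K Y Z)).prod) :
    (b.map (gen K Y Z)).foldl (· * ·) (tensor K Y Z (u ⊗ₜ v)) = tensor K Y Z (u ⊗ₜ v') := by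
  induction b generalizing v with
  | nil =>
    obtain rfl : v' = v := Subtype.ext (by simpa using h)
    rfl
  | cons x b ih =>
    rw [List.map_cons, List.foldl_cons, tensor_mul_gen]
    refine ih _ ?_
    rw [h, List.map_cons, List.prod_cons, ← mul_assoc]
    rfl

theorem bracket_gen {a b : List (Y ⊕ Z)} (ha : a ≠ []) (hb : b ≠ []) :
    bracket (a.map (gen K Y Z)) (b.map (gen K Y Z)) =
      tensor K Y Z (omegaProd K a ha ⊗ₜ omegaProd K b hb) := by
  induction a with
  | nil => exact absurd rfl ha
  | cons x a ih =>
    rcases eq_or_ne a [] with rfl | ha'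
    · obtain ⟨y, b, rfl⟩ := List.exists_cons_of_ne_nil hb
      rw [List.map_cons, List.map_cons, List.map_nil, bracket, List.foldl_cons, gen_mul_gen,
        omegaProd_singleton]
      exact foldl_tensor _ b _ _ (by simp [omegaProd, omegaGen])
    · rw [List.map_cons, bracket_cons _ (by simpa using ha'), ih ha', gen_mul_tensor,
        omegaProd_cons x ha']

variable (K Y Z) in
/-- The basis of `G(X)` that consists of the generators and the tensors of two ordered words. -/
noncomputable def basis [LinearOrder Y] [LinearOrder Z] (hK : ringChar K ≠ 2) :
    Module.Basis ((Y ⊕ Z) ⊕ (OrderedWord Y Z × OrderedWord Y Z)) K (GSup K Y Z) :=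
  Module.Basis.prod (Finsupp.basisSingleOne (R := K) (ι := Y ⊕ Z))
    ((omegaBasis hK).tensorProduct (omegaBasis hK))

theorem basis_inl [LinearOrder Y] [LinearOrder Z] (hK : ringChar K ≠ 2) (x : Y ⊕ Z) :
    basis K Y Z hK (.inl x) = gen K Y Z x := by
  refine (Module.Basis.prod_apply _ _ _).trans ?_
  simp [gen]

theorem basis_inr [LinearOrder Y] [LinearOrder Z] (hK : ringChar K ≠ 2) (a b : OrderedWord Y Z) :
    basis K Y Z hK (.inr (a, b)) = tensor K Y Z
      (omegaProd K a.letters a.letters_ne_nil ⊗ₜ omegaProd K b.letters b.letters_ne_nil) := by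
  refine (Module.Basis.prod_apply _ _ _).trans ?_
  simp only [Module.Basis.tensorProduct_apply, omegaBasis_apply, Sum.elim_inr, Function.comp_apply]
  rfl

end GSup

namespace FreeBicomm

theorem map_bracket {A : Type*} [NonUnitalNonAssocRing A] [Module K A]
    (φ : FreeBicomm K Y Z →ₙₐ[K] A) (a b : List (FreeBicomm K Y Z)) :
    φ (bracket a b) = bracket (a.map φ) (b.map φ) := by
  induction a with
  | nil => exact map_zero φ
  | cons x a ih =>
    rcases eq_or_ne a [] with rfl | ha
    · clear ih
      rw [List.map_cons, List.map_nil, bracket, bracket]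
      induction b generalizing x with
      | nil => rfl
      | cons y b ih' => rw [List.foldl_cons, List.map_cons, List.foldl_cons, ih', map_mul]
    · rw [bracket_cons _ ha, map_mul, ih, List.map_cons, bracket_cons _ (by simpa using ha)]

theorem foldl_mem_grading (b : List (Y ⊕ Z)) {i : ZMod 2} {u : FreeBicomm K Y Z}
    (hu : u ∈ grading K Y Z i) :
    (b.map (gen K Y Z)).foldl (· * ·) u ∈ grading K Y Z (i + (b.map genParity).sum) := by
  induction b generalizing i u with
  | nil => simpa using hu
  | cons x b ih =>
    rw [List.map_cons, List.map_cons, List.foldl_cons, List.sum_cons, ← add_assoc]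
    exact ih (identities.mul_mem hu (gen_mem_grading x))

theorem bracket_mem_grading {a : List (Y ⊕ Z)} (ha : a ≠ []) (b : List (Y ⊕ Z)) :
    bracket (a.map (gen K Y Z)) (b.map (gen K Y Z)) ∈
      grading K Y Z ((a.map genParity).sum + (b.map genParity).sum) := by
  induction a with
  | nil => exact absurd rfl ha
  | cons x a ih =>
    rcases eq_or_ne a [] with rfl | ha'
    · simp only [List.map_cons, List.map_nil, List.sum_singleton, bracket]
      exact foldl_mem_grading b (gen_mem_grading x)
    · simp only [List.map_cons, List.sum_cons]
      rw [bracket_cons _ (by simpa using ha'), add_assoc]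
      exact identities.mul_mem (gen_mem_grading x) (ih ha')

/-! ### The actions of the free super-commutative algebra on `F` -/

theorem left_comm_of_mem (hK : ringChar K ≠ 2) {i j : ZMod 2} {a b : FreeBicomm K Y Z}
    (ha : a ∈ grading K Y Z i) (hb : b ∈ grading K Y Z j) (w : FreeBicomm K Y Z) :
    a * (b * w) = koszulSign i j • (b * (a * w)) := by
  induction w using (isBicommutativeSuperalgebra hK).homogeneous_induction with
  | add v w hv hw => simp only [mul_add, hv, hw, smul_add]
  | hom k w hw => exact identities.left_comm ha hb hw

theorem right_comm_of_mem (hK : ringChar K ≠ 2) {i j : ZMod 2} {b c : FreeBicomm K Y Z}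
    (hb : b ∈ grading K Y Z i) (hc : c ∈ grading K Y Z j) (w : FreeBicomm K Y Z) :
    (w * b) * c = koszulSign i j • ((w * c) * b) := by
  induction w using (isBicommutativeSuperalgebra hK).homogeneous_induction with
  | add v w hv hw => simp only [add_mul, hv, hw, smul_add]
  | hom k w hw => exact identities.right_comm hw hb hc

/-- The left action of the free super-commutative algebra on `F`, in which a generator acts by left
multiplication. -/
noncomputable def leftAct (hK : ringChar K ≠ 2) :
    FreeSuperComm K Y Z →ₐ[K] Module.End K (FreeBicomm K Y Z) :=
  FreeSuperComm.lift (fun x => LinearMap.mulLeft K (gen K Y Z x))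
    (fun y x => LinearMap.ext fun w => by
      have h := left_comm_of_mem hK (gen_mem_grading (K := K) (.inl y)) (gen_mem_grading x) w
      rwa [genParity, koszulSign_zero_left, one_smul] at h)
    (fun z₁ z₂ => LinearMap.ext fun w => by
      have h := left_comm_of_mem hK (gen_mem_grading (K := K) (Y := Y) (.inr z₂))
        (gen_mem_grading (.inr z₁)) w
      rwa [genParity, genParity, koszulSign_one_one, neg_smul, one_smul] at h)

/-- The right action of the free super-commutative algebra on `F`, in which a generator acts by
right multiplication. -/
noncomputable def rightAct (hK : ringChar K ≠ 2) :
    FreeSuperComm K Y Z →ₐ[K] (Module.End K (FreeBicomm K Y Z))ᵐᵒᵖ :=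
  FreeSuperComm.lift (fun x => MulOpposite.op (LinearMap.mulRight K (gen K Y Z x)))
    (fun y x => MulOpposite.unop_injective <| LinearMap.ext fun w => by
      have h := right_comm_of_mem hK (gen_mem_grading (K := K) (.inl y)) (gen_mem_grading x) w
      rwa [genParity, koszulSign_zero_left, one_smul] at h)
    (fun z₁ z₂ => MulOpposite.unop_injective <| LinearMap.ext fun w => by
      have h := right_comm_of_mem hK (gen_mem_grading (K := K) (Y := Y) (.inr z₂))
        (gen_mem_grading (.inr z₁)) w
      rwa [genParity, genParity, koszulSign_one_one, neg_smul, one_smul] at h)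

theorem leftAct_cons (hK : ringChar K ≠ 2) (x : Y ⊕ Z) (l : List (Y ⊕ Z))
    (w : FreeBicomm K Y Z) :
    leftAct hK ((x :: l).map (FreeSuperComm.gen K Y Z)).prod w =
      gen K Y Z x * leftAct hK (l.map (FreeSuperComm.gen K Y Z)).prod w := by
  have h : leftAct hK (FreeSuperComm.gen K Y Z x) = LinearMap.mulLeft K (gen K Y Z x) :=
    FreeSuperComm.lift_gen _ _ _ _
  rw [List.map_cons, List.prod_cons, map_mul, h]
  rfl

theorem rightAct_prod (hK : ringChar K ≠ 2) (l : List (Y ⊕ Z)) (w : FreeBicomm K Y Z) :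
    (rightAct hK (l.map (FreeSuperComm.gen K Y Z)).prod).unop w =
      (l.map (gen K Y Z)).foldl (· * ·) w := by
  induction l generalizing w with
  | nil =>
    rw [List.map_nil, List.prod_nil, map_one]
    rfl
  | cons x l ih =>
    have h : rightAct hK (FreeSuperComm.gen K Y Z x) =
        MulOpposite.op (LinearMap.mulRight K (gen K Y Z x)) :=
      FreeSuperComm.lift_gen _ _ _ _
    rw [List.map_cons, List.map_cons, List.prod_cons, map_mul, h, MulOpposite.unop_mul,
      List.foldl_cons, ← ih]
    rfl

theorem bracket_concat (hK : ringChar K ≠ 2) (l : List (Y ⊕ Z)) (x : Y ⊕ Z) (b : List (Y ⊕ Z)) :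
    bracket ((l ++ [x]).map (gen K Y Z)) (b.map (gen K Y Z)) =
      leftAct hK (l.map (FreeSuperComm.gen K Y Z)).prod
        ((rightAct hK (b.map (FreeSuperComm.gen K Y Z)).prod).unop (gen K Y Z x)) := by
  induction l with
  | nil =>
    rw [rightAct_prod, List.map_nil, List.prod_nil, map_one]
    rfl
  | cons y l ih =>
    rw [leftAct_cons, ← ih, List.cons_append, List.map_cons, bracket_cons _ (by simp)]

theorem mul_foldl (hK : ringChar K ≠ 2) (a : FreeBicomm K Y Z) (b : List (Y ⊕ Z))
    {w : FreeBicomm K Y Z} (hw : w ∈ square K (FreeBicomm K Y Z)) :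
    a * (b.map (gen K Y Z)).foldl (· * ·) w = (b.map (gen K Y Z)).foldl (· * ·) (a * w) := by
  induction b generalizing w with
  | nil => rfl
  | cons x b ih =>
    rw [List.map_cons, List.foldl_cons, List.foldl_cons, ih (Submodule.subset_span ⟨w, _, rfl⟩),
      (isBicommutativeSuperalgebra hK).mul_square_mul hw]

/-- In a bracket the left multiplications can be performed before the right ones, except for the
first right one: the elements of `F²` associate with the elements around them. -/
theorem bracket_cons_right (hK : ringChar K ≠ 2) {a : List (Y ⊕ Z)} (ha : a ≠ []) (x : Y ⊕ Z)
    (b : List (Y ⊕ Z)) :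
    bracket (a.map (gen K Y Z)) ((x :: b).map (gen K Y Z)) =
      (rightAct hK (b.map (FreeSuperComm.gen K Y Z)).prod).unop
        (leftAct hK (a.map (FreeSuperComm.gen K Y Z)).prod (gen K Y Z x)) := by
  rw [rightAct_prod]
  induction a with
  | nil => exact absurd rfl ha
  | cons y a ih =>
    rcases eq_or_ne a [] with rfl | ha'
    · rw [leftAct_cons, List.map_nil, List.prod_nil, map_one]
      rfl
    · obtain ⟨y', a', rfl⟩ := List.exists_cons_of_ne_nil ha'
      rw [List.map_cons, bracket_cons _ (by simp), ih ha', leftAct_cons hK y, mul_foldl hK]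
      rw [leftAct_cons]
      exact Submodule.subset_span ⟨_, _, rfl⟩

/-! ### The spanning monomials -/

variable (K Y Z) in
/-- The span of the brackets of nonempty words in the generators. -/
noncomputable def bracketSpan : Submodule K (FreeBicomm K Y Z) :=
  Submodule.span K {t | ∃ a b : List (Y ⊕ Z), a ≠ [] ∧ b ≠ [] ∧
    t = bracket (a.map (gen K Y Z)) (b.map (gen K Y Z))}

theorem gen_mul_mem_bracketSpan (x : Y ⊕ Z) {n : FreeBicomm K Y Z} (hn : n ∈ bracketSpan K Y Z) :
    gen K Y Z x * n ∈ bracketSpan K Y Z := by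
  refine Submodule.span_le (p := (bracketSpan K Y Z).comap
    (LinearMap.mulLeft K (gen K Y Z x))).2 ?_ hn
  rintro _ ⟨a, b, ha, hb, rfl⟩
  exact Submodule.subset_span ⟨x :: a, b, List.cons_ne_nil _ _, hb, by
    rw [List.map_cons, bracket_cons _ (by simpa using ha)]
    rfl⟩

theorem mul_gen_mem_bracketSpan (hK : ringChar K ≠ 2) (x : Y ⊕ Z) {n : FreeBicomm K Y Z}
    (hn : n ∈ bracketSpan K Y Z) : n * gen K Y Z x ∈ bracketSpan K Y Z := by
  refine Submodule.span_le (p := (bracketSpan K Y Z).comap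
    (LinearMap.mulRight K (gen K Y Z x))).2 ?_ hn
  rintro _ ⟨a, b, ha, hb, rfl⟩
  refine Submodule.subset_span ⟨a, b ++ [x], ha, by simp, ?_⟩
  obtain ⟨y, b, rfl⟩ := List.exists_cons_of_ne_nil hb
  rw [List.cons_append, bracket_cons_right hK ha, bracket_cons_right hK ha, rightAct_prod,
    rightAct_prod, List.map_append, List.foldl_append]
  rfl

variable (K) in
/-- The value in `F` of a nonassociative word. -/
noncomputable def word (w : FreeMagma (Y ⊕ Z)) : FreeBicomm K Y Z :=
  mk K Y Z (MonoidAlgebra.ofMagma K (FreeMagma (Y ⊕ Z)) w)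

theorem word_mul (v w : FreeMagma (Y ⊕ Z)) : word K (v * w) = word K v * word K w := by
  rw [word, map_mul]
  rfl

theorem word_mem_grading (w : FreeMagma (Y ⊕ Z)) : word K w ∈ grading K Y Z (wordParity w) :=
  Submodule.mem_map_of_mem (Submodule.subset_span ⟨w, rfl, rfl⟩)

/-- The span of the brackets is an ideal: a product `uv` acts on it from the left as `u` from the
left and `v` from the right, and similarly from the right. -/
theorem word_mul_mem_bracketSpan (hK : ringChar K ≠ 2) (w : FreeMagma (Y ⊕ Z)) :
    ∀ n ∈ bracketSpan K Y Z,
      word K w * n ∈ bracketSpan K Y Z ∧ n * word K w ∈ bracketSpan K Y Z := by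
  induction w with
  | ih1 x => exact fun n hn => ⟨gen_mul_mem_bracketSpan x hn, mul_gen_mem_bracketSpan hK x hn⟩
  | ih2 u v hu hv =>
    intro n hn
    rw [word_mul]
    have h := hn
    induction h using Submodule.span_induction with
    | zero => simp
    | add x y hx hy ihx ihy =>
      rw [mul_add, add_mul]
      exact ⟨add_mem (ihx hx).1 (ihy hy).1, add_mem (ihx hx).2 (ihy hy).2⟩
    | smul t x hx ih =>
      rw [mul_smul_comm, smul_mul_assoc]
      exact ⟨Submodule.smul_mem _ _ (ih hx).1, Submodule.smul_mem _ _ (ih hx).2⟩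
    | mem x hx =>
      obtain ⟨a, b, ha, hb, rfl⟩ := hx
      have hab := bracket_mem_grading (K := K) ha b
      rw [right_comm_of_mem hK (word_mem_grading v) hab,
        left_comm_of_mem hK hab (word_mem_grading u)]
      exact ⟨zsmul_mem (hv _ (hu _ hn).1).2 _, zsmul_mem (hu _ (hv _ hn).2).1 _⟩

theorem word_mem (hK : ringChar K ≠ 2) (w : FreeMagma (Y ⊕ Z)) :
    (∃ x, word K w = gen K Y Z x) ∨ word K w ∈ bracketSpan K Y Z := by
  induction w with
  | ih1 x => exact Or.inl ⟨x, rfl⟩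
  | ih2 u v hu hv =>
    right
    rw [word_mul]
    rcases hu with ⟨x, hx⟩ | hu
    · rcases hv with ⟨x', hx'⟩ | hv
      · exact Submodule.subset_span ⟨[x], [x'], by simp, by simp, by rw [hx, hx']; rfl⟩
      · exact (word_mul_mem_bracketSpan hK u _ hv).1
    · exact (word_mul_mem_bracketSpan hK v _ hu).2

variable [LinearOrder Y] [LinearOrder Z]

theorem bracketSpan_le (hK : ringChar K ≠ 2) :
    bracketSpan K Y Z ≤ Submodule.span K (Set.range (basisFamily K Y Z)) := by
  refine Submodule.span_le.2 ?_
  rintro _ ⟨a, b, ha, hb, rfl⟩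
  have hb' := hb
  obtain ⟨x, b, rfl⟩ := List.exists_cons_of_ne_nil hb
  rw [bracket_cons_right hK ha]
  -- the bracket is linear in the value of its first word, which is then reduced to ordered words
  refine Submodule.span_le (p := (Submodule.span K (Set.range (basisFamily K Y Z))).comap
    ((rightAct hK (b.map (FreeSuperComm.gen K Y Z)).prod).unop ∘ₗ
      (LinearMap.applyₗ (gen K Y Z x)) ∘ₗ (leftAct hK).toLinearMap)).2 ?_
    (FreeSuperComm.prod_letters_mem_span hK ha)
  rintro _ ⟨w, rfl⟩
  change (rightAct hK (b.map (FreeSuperComm.gen K Y Z)).prod).unop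
    (leftAct hK (w.letters.map (FreeSuperComm.gen K Y Z)).prod (gen K Y Z x)) ∈
      Submodule.span K (Set.range (basisFamily K Y Z))
  rw [← bracket_cons_right hK w.letters_ne_nil]
  obtain ⟨l, y, hl⟩ : ∃ l y, w.letters = l ++ [y] :=
    ⟨_, _, (List.dropLast_append_getLast w.letters_ne_nil).symm⟩
  rw [hl, bracket_concat hK]
  -- and linear in the value of its second word
  refine Submodule.span_le (p := (Submodule.span K (Set.range (basisFamily K Y Z))).comap
    (leftAct hK (l.map (FreeSuperComm.gen K Y Z)).prod ∘ₗ (LinearMap.applyₗ (gen K Y Z y)) ∘ₗ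
      (MulOpposite.opLinearEquiv K).symm.toLinearMap ∘ₗ (rightAct hK).toLinearMap)).2 ?_
    (FreeSuperComm.prod_letters_mem_span hK hb')
  rintro _ ⟨w', rfl⟩
  change leftAct hK (l.map (FreeSuperComm.gen K Y Z)).prod
    ((rightAct hK (w'.letters.map (FreeSuperComm.gen K Y Z)).prod).unop (gen K Y Z y)) ∈
      Submodule.span K (Set.range (basisFamily K Y Z))
  rw [← bracket_concat, ← hl]
  exact Submodule.subset_span ⟨.inr (w, w'), rfl⟩

theorem span_basisFamily (hK : ringChar K ≠ 2) :
    Submodule.span K (Set.range (basisFamily K Y Z)) = ⊤ := by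
  rw [eq_top_iff]
  rintro a -
  obtain ⟨a, rfl⟩ := mk_surjective K Y Z a
  induction a using MonoidAlgebra.induction_linear with
  | zero => rw [map_zero]; exact zero_mem _
  | add x y hx hy => rw [map_add]; exact add_mem hx hy
  | single w r =>
    have hr : MonoidAlgebra.single w r = r • MonoidAlgebra.ofMagma K (FreeMagma (Y ⊕ Z)) w := by
      simp [MonoidAlgebra.ofMagma]
    rw [hr, map_smul]
    refine Submodule.smul_mem _ _ ?_
    rcases word_mem hK w with ⟨x, hx⟩ | h
    · exact Submodule.subset_span ⟨.inl x, hx.symm⟩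
    · exact bracketSpan_le hK h

/-! ### The isomorphism -/

theorem map_basisFamily (hK : ringChar K ≠ 2) {φ : FreeBicomm K Y Z →ₙₐ[K] GSup K Y Z}
    (hφ : ∀ x, φ (gen K Y Z x) = GSup.gen K Y Z x)
    (i : (Y ⊕ Z) ⊕ (OrderedWord Y Z × OrderedWord Y Z)) :
    φ (basisFamily K Y Z i) = GSup.basis K Y Z hK i := by
  rcases i with x | ⟨a, b⟩
  · rw [GSup.basis_inl]
    exact hφ x
  · have hc : φ ∘ gen K Y Z = GSup.gen K Y Z := funext hφ
    rw [GSup.basis_inr, basisFamily, map_bracket, List.map_map, List.map_map, hc,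
      GSup.bracket_gen a.letters_ne_nil b.letters_ne_nil]

theorem linearIndependent_basisFamily (hK : ringChar K ≠ 2) :
    LinearIndependent K (basisFamily K Y Z) := by
  obtain ⟨φ, hφ, -⟩ := exists_hom (K := K) (Y := Y) (Z := Z) GSup.identities _ GSup.gen_mem_grading
  refine LinearIndependent.of_comp (φ : FreeBicomm K Y Z →ₗ[K] GSup K Y Z) ?_
  convert (GSup.basis K Y Z hK).linearIndependent using 1
  exact funext (map_basisFamily hK hφ)

omit [LinearOrder Y] [LinearOrder Z] in
theorem grading_le_map {φ : FreeBicomm K Y Z →ₙₐ[K] GSup K Y Z}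
    (hφ : ∀ x, φ (gen K Y Z x) = GSup.gen K Y Z x) (i : ZMod 2) :
    GSup.grading K Y Z i ≤ (grading K Y Z i).map (φ : FreeBicomm K Y Z →ₗ[K] GSup K Y Z) := by
  have hc : φ ∘ gen K Y Z = GSup.gen K Y Z := funext hφ
  refine Submodule.span_le.2 ?_
  rintro _ (⟨x, rfl, rfl⟩ | ⟨j, k, u, v, rfl, hu, hv, rfl⟩)
  · exact ⟨_, gen_mem_grading x, hφ x⟩
  · rw [SetLike.mem_coe]
    have hu' := FreeSuperComm.mem_span_omegaProd hu
    have hv' := FreeSuperComm.mem_span_omegaProd hv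
    clear hu hv
    induction hu', hv' using Submodule.span_induction₂ with
    | mem_mem x y hx hy =>
      obtain ⟨a, ha, rfl, rfl⟩ := hx
      obtain ⟨b, hb, rfl, rfl⟩ := hy
      refine ⟨_, bracket_mem_grading ha b, ?_⟩
      change φ _ = _
      rw [map_bracket, List.map_map, List.map_map, hc, GSup.bracket_gen ha hb]
    | zero_left y hy => rw [TensorProduct.zero_tmul, map_zero]; exact zero_mem _
    | zero_right x hx => rw [TensorProduct.tmul_zero, map_zero]; exact zero_mem _
    | add_left x y z _ _ _ hx hy => rw [TensorProduct.add_tmul, map_add]; exact add_mem hx hy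
    | add_right x y z _ _ _ hx hy => rw [TensorProduct.tmul_add, map_add]; exact add_mem hx hy
    | smul_left t x y _ _ h =>
      rw [← TensorProduct.smul_tmul', map_smul]; exact Submodule.smul_mem _ _ h
    | smul_right t x y _ _ h =>
      rw [TensorProduct.tmul_smul, map_smul]; exact Submodule.smul_mem _ _ h

theorem exists_equiv (hK : ringChar K ≠ 2) :
    ∃ e : FreeBicomm K Y Z ≃ₗ[K] GSup K Y Z, (∀ a b, e (a * b) = e a * e b) ∧
      (∀ x, e (gen K Y Z x) = GSup.gen K Y Z x) ∧
      ∀ i a, a ∈ grading K Y Z i ↔ e a ∈ GSup.grading K Y Z i := by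
  obtain ⟨φ, hφ, hg⟩ := exists_hom (K := K) (Y := Y) (Z := Z) GSup.identities _ GSup.gen_mem_grading
  let b := Module.Basis.mk (linearIndependent_basisFamily (K := K) (Y := Y) (Z := Z) hK)
    (span_basisFamily hK).ge
  let e := b.equiv (GSup.basis K Y Z hK) (Equiv.refl _)
  have he : e.toLinearMap = (φ : FreeBicomm K Y Z →ₗ[K] GSup K Y Z) := b.ext fun i => by
    change e (b i) = φ (b i)
    rw [Module.Basis.equiv_apply, Module.Basis.mk_apply, map_basisFamily hK hφ]
    rfl
  have he' (a) : e a = φ a := LinearMap.congr_fun he a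
  refine ⟨e, fun a b => by rw [he', he', he', map_mul], fun x => by rw [he', hφ], fun i a =>
    ⟨fun h => he' a ▸ hg i a h, fun h => ?_⟩⟩
  obtain ⟨a', ha', h⟩ := grading_le_map hφ i h
  rwa [← e.injective ((he' a').trans h)]

end FreeBicomm

end BicommSuper

theorem theorem2p7 {K : Type*} [Field K] (hK : ringChar K ≠ 2)
    {Y Z : Type*} [LinearOrder Y] [LinearOrder Z] :
    -- `FreeBicomm K Y Z` is the free bicommutative superalgebra on `Y` (even) and `Z` (odd)
    (BicommSuper.IsBicommutativeSuperalgebra (BicommSuper.FreeBicomm.grading K Y Z) ∧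
      (∀ x : Y ⊕ Z, BicommSuper.FreeBicomm.gen K Y Z x ∈
        BicommSuper.FreeBicomm.grading K Y Z (BicommSuper.genParity x)) ∧
      ∀ {A : Type*} [NonUnitalNonAssocRing A] [Module K A] [IsScalarTower K A A]
        [SMulCommClass K A A] (𝒜 : ZMod 2 → Submodule K A),
        BicommSuper.IsBicommutativeSuperalgebra 𝒜 →
        ∀ f : Y ⊕ Z → A, (∀ x, f x ∈ 𝒜 (BicommSuper.genParity x)) →
          ∃! φ : BicommSuper.FreeBicomm K Y Z →ₙₐ[K] A,
            (∀ x, φ (BicommSuper.FreeBicomm.gen K Y Z x) = f x) ∧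
            ∀ i, ∀ a ∈ BicommSuper.FreeBicomm.grading K Y Z i, φ a ∈ 𝒜 i) ∧
    -- `X ∪ M` is a basis
    (LinearIndependent K (BicommSuper.basisFamily K Y Z) ∧
      Submodule.span K (Set.range (BicommSuper.basisFamily K Y Z)) = ⊤) ∧
    -- the isomorphism of superalgebras with `G(X)`
    (∃ e : BicommSuper.FreeBicomm K Y Z ≃ₗ[K] BicommSuper.GSup K Y Z,
      (∀ a b, e (a * b) = e a * e b) ∧
      (∀ x, e (BicommSuper.FreeBicomm.gen K Y Z x) = BicommSuper.GSup.gen K Y Z x) ∧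
      ∀ i a, a ∈ BicommSuper.FreeBicomm.grading K Y Z i ↔
        e a ∈ BicommSuper.GSup.grading K Y Z i) ∧
    -- the square of a bicommutative superalgebra
    (∀ {A : Type*} [NonUnitalNonAssocRing A] [Module K A] [IsScalarTower K A A]
      [SMulCommClass K A A] (𝒜 : ZMod 2 → Submodule K A),
      BicommSuper.IsBicommutativeSuperalgebra 𝒜 →
        BicommSuper.IsSuperalgebra
          (BicommSuper.inducedGrading 𝒜 (BicommSuper.square K A)) ∧
        (∀ a b c : BicommSuper.square K A, a * b * c = a * (b * c)) ∧
        BicommSuper.IsSuperCommutative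
          (BicommSuper.inducedGrading 𝒜 (BicommSuper.square K A))) := by
  refine ⟨⟨BicommSuper.FreeBicomm.isBicommutativeSuperalgebra hK,
    BicommSuper.FreeBicomm.gen_mem_grading, ?_⟩,
    ⟨BicommSuper.FreeBicomm.linearIndependent_basisFamily hK,
      BicommSuper.FreeBicomm.span_basisFamily hK⟩,
    BicommSuper.FreeBicomm.exists_equiv hK, ?_⟩
  · intro A _ _ _ _ 𝒜 h f hf
    obtain ⟨φ, hφ, hg⟩ := BicommSuper.FreeBicomm.exists_hom h.identities f hf
    exact ⟨φ, ⟨hφ, hg⟩, fun ψ hψ => BicommSuper.FreeBicomm.hom_ext fun x => by rw [hψ.1, hφ]⟩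
  · intro A _ _ _ _ 𝒜 h
    exact ⟨h.square, fun a b c => Subtype.ext (h.mul_square_mul b.2 a c),
      h.square_superCommutative⟩
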